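/- **Conventions.** Let $p$ be a prime. Subgroups of profinite groups are closed and homomorphisms between them are continuous; "$p$-subgroup" and "Sylow $p$-subgroup" of a profinite group mean pro-$p$ subgroup and Sylow pro-$p$ subgroup. For subgroups $X,Q\le S$, $\mathrm{Aut}_X(Q)$ is the image of $N_X(Q)$ in the automorphism group of $Q$ under conjugation. **Pro-fusion systems.** A *fusion system* on a finite $p$-group $S$ is a category whose objects are the subgroups of $S$ and whose morphisms are injective group homomorphisms, which contains every homomorphism $P\to Q$ induced by conjugation by an element of $S$ and in which every morphism is an isomorphism of the category followed by an inclusion. A *morphism* $\mathcal F\to\mathcal G$ of fusion systems on $S$ and $S'$ is a homomorphism $\alpha:S\to S'$ for which there is a functor $A:\mathcal F\to\mathcal G$ with $A(P)=\alpha(P)$ for all $P\le S$ and $\alpha\varphi=A(\varphi)\alpha$ for all morphisms $\varphi$ of $\mathcal F$. Given an inverse system, over a directed set $I$, of fusion systems $\mathcal F_i$ on finite $p$-groups $S_i$, let $S=\varprojlim S_i$ with projections $f_i:S\to S_i$. The *pro-fusion system* $\mathcal F=\varprojlim\mathcal F_i$ on the pro-$p$ group $S$ is the category whose objects are the closed subgroups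 of $S$, with $\mathrm{Hom}_{\mathcal F}(P,Q)=\varprojlim \mathrm{Hom}_{\mathcal F_i}(f_i(P),f_i(Q))$, a profinite set of homomorphisms $P\to Q$. A closed subgroup $T\le S$ is *strongly $\mathcal F$-closed* if $\varphi(R)\le T$ for all $R\le T$ and all $\varphi\in\mathrm{Hom}_{\mathcal F}(R,S)$. **$T$-subsystems.** Let $T$ be strongly $\mathcal F$-closed. A *$T$-subsystem* $\mathcal E$ of $\mathcal F$ is a subcategory on the same objects such that every $\mathrm{Hom}_{\mathcal E}(P,Q)$ is closed in $\mathrm{Hom}_{\mathcal F}(P,Q)$ and 1. $\mathcal E$ contains every homomorphism $P\to Q$ induced by conjugation by an element of $T$; 2. every morphism of $\mathcal E$ is an isomorphism of $\mathcal E$ followed by an inclusion; 3. $\varphi|_{P'}\,\mathrm{Hom}_{\mathcal E}(P,P')=\mathrm{Hom}_{\mathcal E}(\varphi(P),\varphi(P'))\,\varphi|_P$ for all $P,P'\le Q\le S$ and $\varphi\in\mathrm{Hom}_{\mathcal F}(Q,S)$; 4. $\psi(u)u^{-1}\in T$ for all $Q\le S$, $\psi\in\mathrm{Hom}_{\mathcal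 E}(Q,S)$ and $u\in Q$. **Saturation.** A subgroup $Q\le S$ is *receptive in $\mathcal E$* if for all $R\le S$ every $\varphi\in\mathrm{Iso}_{\mathcal E}(R,Q)$ extends to a morphism $N^T_\varphi\to N_T(Q)Q$ of $\mathcal E$, where $$N^T_\varphi=\{x\in N_T(R)R \mid \exists\, y\in N_T(Q)Q,\ \forall u\in R,\ \varphi(xux^{-1})=y\varphi(u)y^{-1}\}.$$ It is *fully normalized in $\mathcal E$* if it is receptive in $\mathcal E$ and $\mathrm{Aut}_T(Q)$ is a Sylow $p$-subgroup of the profinite group $\mathrm{Aut}_{\mathcal E}(Q)$. The $T$-subsystem $\mathcal E$ is *saturated* if every $\mathcal E$-isomorphism class of closed subgroups of $S$ contains a subgroup that is fully normalized in $\mathcal E$. **Essential subgroups.** $Q$ is *$\mathcal E$-centric* if $C_T(Q')\le Z(Q')$ for all $Q'$ in the $\mathcal E$-isomorphism class of $Q$. For a profinite group $G$ let $\mathcal S_p(G)$ be the poset of non-trivial $p$-subgroups of $G$. $Q$ is *$\mathcal E$-essential* if $T\le Q$, or if $Q$ is $\mathcal E$-centric and $\mathcal S_p\big(\mathrm{Aut}_{\mathcal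 E}(Q)/\mathrm{Aut}_{T\cap Q}(Q)\big)$ is disconnected or empty. **Theorem.** Let $\mathcal F$ be a pro-fusion system on $S$, let $T$ be a strongly $\mathcal F$-closed subgroup of $S$ and let $\mathcal E$ be a saturated $T$-subsystem of $\mathcal F$. Let $P$ and $P'$ be open subgroups of $S$ and let $\varphi\in\mathrm{Iso}_{\mathcal E}(P,P')$. Then there are an integer $n\ge 0$, open subgroups $P=P_0,P_1,\dots,P_n=P'$ and $Q_1,\dots,Q_n$ of $S$, and automorphisms $\varphi_i\in\mathrm{Aut}_{\mathcal E}(Q_i)$ for $1\le i\le n$, such that (a) each $Q_i$ is $\mathcal E$-essential and fully normalized in $\mathcal E$; (b) $P_{i-1},P_i\le Q_i$ and $\varphi_i(P_{i-1})=P_i$ for each $i$; (c) $\varphi(u)=\varphi_n\cdots\varphi_2\varphi_1(u)$ for all $u\in P$. -/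

import Mathlib

universe u v w

/-- The homomorphism `P → Q`, `x ↦ s x s⁻¹`, where `s P s⁻¹ ≤ Q`. -/
def conjHom {S A : Type*} [Group S] [SetLike A S] [SubgroupClass A S] (s : S) (P Q : A)
    (h : ∀ x ∈ P, s * x * s⁻¹ ∈ Q) : P →* Q where
  toFun x := ⟨s * x * s⁻¹, h x x.2⟩
  map_one' := by ext; simp
  map_mul' x y := by ext; simp

/-- The inclusion homomorphism `P → Q`, where `P ≤ Q`. -/
def inclHom {S A : Type*} [Group S] [SetLike A S] [SubgroupClass A S] (P Q : A)
    (h : ∀ x ∈ P, x ∈ Q) : P →* Q where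
  toFun x := ⟨x, h x x.2⟩
  map_one' := by ext; simp
  map_mul' x y := by ext; simp

/-! ### Fusion systems on finite groups and their morphisms -/

/-- A fusion system on the group `S` (which will be a finite `p`-group): a category whose objects
are the subgroups of `S` and whose morphisms are injective group homomorphisms, which contains the
homomorphisms induced by conjugation in `S`, and in which every morphism is an isomorphism
followed by an inclusion. -/
structure FusionSystem (S : Type w) [Group S] where
  Hom : (P Q : Subgroup S) → Set (P →* Q)
  injective : ∀ {P Q : Subgroup S} {φ : P →* Q}, φ ∈ Hom P Q → Function.Injective φ
  id_mem : ∀ P : Subgroup S, MonoidHom.id P ∈ Hom P P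
  comp_mem : ∀ {P Q R : Subgroup S} {ψ : Q →* R} {φ : P →* Q},
    ψ ∈ Hom Q R → φ ∈ Hom P Q → ψ.comp φ ∈ Hom P R
  conj_mem : ∀ (s : S) (P Q : Subgroup S) (h : ∀ x ∈ P, s * x * s⁻¹ ∈ Q),
    conjHom s P Q h ∈ Hom P Q
  factor : ∀ {P Q : Subgroup S} {φ : P →* Q}, φ ∈ Hom P Q →
    ∃ (R : Subgroup S) (h : ∀ x ∈ R, x ∈ Q) (θ : P ≃* R),
      θ.toMonoidHom ∈ Hom P R ∧ θ.symm.toMonoidHom ∈ Hom R P ∧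
        φ = (inclHom R Q h).comp θ.toMonoidHom

/-- The relation `α ∘ φ = ψ ∘ α` for `φ : P → Q` and `ψ : α(P) → α(Q)`. For given `α` and `φ` there
is at most one such `ψ`. -/
def FusionSystem.Induces {S S' : Type*} [Group S] [Group S'] {P Q : Subgroup S} (α : S →* S')
    (φ : P →* Q) (ψ : P.map α →* Q.map α) : Prop :=
  ∀ x : P, ((ψ ⟨α x, Subgroup.mem_map_of_mem α x.2⟩ : Q.map α) : S') = α (φ x)

/-- The group homomorphism `α` is a morphism of fusion systems from `F` to `F'`: there is a functor
`A` from `F` to `F'` with `A(P) = α(P)` on objects and `α φ = A(φ) α` on morphisms. As `A(φ)` is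
determined by `α` and `φ`, functoriality is automatic. -/
def FusionSystem.IsMorphism {S S' : Type*} [Group S] [Group S'] (F : FusionSystem S)
    (F' : FusionSystem S') (α : S →* S') : Prop :=
  ∀ (P Q : Subgroup S), ∀ φ ∈ F.Hom P Q, ∃ ψ ∈ F'.Hom (P.map α) (Q.map α),
    FusionSystem.Induces α φ ψ

/-! ### Inverse systems and pro-fusion systems -/

/-- An inverse system of fusion systems on finite (discrete) `p`-groups, over a directed set. -/
structure FusionInverseSystem (p : ℕ) where
  I : Type v
  [order : PartialOrder I]
  [directed : IsDirectedOrder I]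
  [nonempty : Nonempty I]
  S : I → Type w
  [group : ∀ i, Group (S i)]
  [finite : ∀ i, Finite (S i)]
  [topology : ∀ i, TopologicalSpace (S i)]
  [discrete : ∀ i, DiscreteTopology (S i)]
  isPGroup : ∀ i, IsPGroup p (S i)
  fusion : ∀ i, FusionSystem (S i)
  map : ∀ {i j : I}, i ≤ j → (S j →* S i)
  map_refl : ∀ i, map (le_refl i) = MonoidHom.id (S i)
  map_comp : ∀ {i j k : I} (hij : i ≤ j) (hjk : j ≤ k),
    (map hij).comp (map hjk) = map (hij.trans hjk)
  isMorphism : ∀ {i j : I} (hij : i ≤ j), (fusion j).IsMorphism (fusion i) (map hij)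

attribute [instance] FusionInverseSystem.order FusionInverseSystem.directed
  FusionInverseSystem.nonempty FusionInverseSystem.group FusionInverseSystem.finite
  FusionInverseSystem.topology FusionInverseSystem.discrete

/-- The inverse limit of the groups `S i`, as a subgroup of the product; it carries the subspace
topology of the product topology. -/
def FusionInverseSystem.limit {p : ℕ} (D : FusionInverseSystem.{v, w} p) :
    Subgroup (∀ i, D.S i) where
  carrier := {x | ∀ (i j : D.I) (h : i ≤ j), D.map h (x j) = x i}
  one_mem' := by intro i j h; simp
  mul_mem' := by intro a b ha hb i j h; simp [ha i j h, hb i j h]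
  inv_mem' := by intro a ha i j h; simp [ha i j h]

/-- A pro-fusion system on the topological group `S`: `S` is identified with the inverse limit of
the groups of an inverse system of fusion systems on finite `p`-groups. The morphisms are given by
`ProFusionSystem.Hom`. -/
structure ProFusionSystem (p : ℕ) (S : Type u) [Group S] [TopologicalSpace S] where
  sys : FusionInverseSystem.{v, w} p
  iso : S ≃ₜ* sys.limit

/-- A set of homomorphisms `P → Q` for any two closed subgroups `P` and `Q` of `S`. -/
abbrev HomFamily (S : Type u) [Group S] [TopologicalSpace S] : Type u :=
  (P Q : ClosedSubgroup S) → Set (P →* Q)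

/-- `θ` is an isomorphism of the category with morphisms `H`. -/
def HomFamily.IsIso {S : Type u} [Group S] [TopologicalSpace S] (H : HomFamily S)
    {P Q : ClosedSubgroup S} (θ : P ≃* Q) : Prop :=
  θ.toMonoidHom ∈ H P Q ∧ θ.symm.toMonoidHom ∈ H Q P

/-- `S` as a closed subgroup of itself. -/
def wholeGroup (S : Type u) [Group S] [TopologicalSpace S] : ClosedSubgroup S :=
  ⟨⊤, isClosed_univ⟩

namespace ProFusionSystem

section

variable {p : ℕ} {S : Type u} [Group S] [TopologicalSpace S] (F : ProFusionSystem.{u, v, w} p S)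

/-- The projection `f_i : S → S_i`. -/
def proj (i : F.sys.I) : S →* F.sys.S i :=
  (Pi.evalMonoidHom F.sys.S i).comp (F.sys.limit.subtype.comp F.iso.toMulEquiv.toMonoidHom)

/-- `Hom_F(P, Q)`, the inverse limit of the sets `Hom_{F_i}(f_i(P), f_i(Q))`: a compatible family
`(φ_i)` is identified with the homomorphism `φ : P → Q` such that `f_i φ = φ_i f_i` for all `i`. -/
def Hom : HomFamily S := fun P Q =>
  {φ | ∀ i, ∃ ψ ∈ (F.sys.fusion i).Hom (P.toSubgroup.map (F.proj i)) (Q.toSubgroup.map (F.proj i)),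
    FusionSystem.Induces (P := P.toSubgroup) (Q := Q.toSubgroup) (F.proj i) φ ψ}

/-- The topology of `Hom_F(P, Q)` as an inverse limit of discrete sets: the component `φ_i` of `φ`
is recorded by the function `f_i φ = φ_i f_i` on `P`. -/
instance homTopology (P Q : ClosedSubgroup S) : TopologicalSpace (F.Hom P Q) :=
  ⨅ i, TopologicalSpace.induced
    (fun (φ : F.Hom P Q) (x : P) => F.proj i (φ.1 x : Q)) (⊥ : TopologicalSpace (P → F.sys.S i))

/-- The closed subgroup `T` is strongly `F`-closed. -/
def StronglyClosed (T : ClosedSubgroup S) : Prop :=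
  ∀ (R : ClosedSubgroup S), ∀ φ ∈ F.Hom R (wholeGroup S), R ≤ T → ∀ x : R, (φ x : S) ∈ T

theorem continuous_proj (i : F.sys.I) : Continuous (F.proj i) :=
  (continuous_apply i).comp (continuous_subtype_val.comp F.iso.continuous)

theorem continuous_of_mem {P Q : ClosedSubgroup S} {φ : P →* Q} (hφ : φ ∈ F.Hom P Q) :
    Continuous φ := by
  refine Continuous.subtype_mk (f := fun x => ((φ x : Q) : S)) ?_ _
  have hi : Topology.IsInducing F.iso := F.iso.toHomeomorph.isInducing
  rw [hi.continuous_iff]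
  refine Continuous.subtype_mk (continuous_pi fun i => ?_) _
  obtain ⟨ψ, -, h⟩ := hφ i
  have key : (fun x : P => F.proj i (φ x : Q)) = fun x : P =>
      ((ψ ⟨F.proj i x, Subgroup.mem_map_of_mem (F.proj i) x.2⟩ :
        Q.toSubgroup.map (F.proj i)) : F.sys.S i) := by
    funext x
    exact (h x).symm
  change Continuous (fun x : P => F.proj i (φ x : Q))
  rw [key]
  refine continuous_subtype_val.comp ((continuous_of_discreteTopology (f := ψ)).comp ?_)
  exact ((F.continuous_proj i).comp continuous_subtype_val).subtype_mk _

/-- The image `φ(P)` of a closed subgroup `P ≤ Q` under a morphism `φ : Q → R` of `F`. -/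
def image [CompactSpace S] [T2Space S] {Q R : ClosedSubgroup S} (φ : Q →* R) (hφ : φ ∈ F.Hom Q R)
    (P : ClosedSubgroup S) (hP : P ≤ Q) : ClosedSubgroup S where
  carrier := {y | ∃ x : P, (φ ⟨x, hP x.2⟩ : S) = y}
  one_mem' := ⟨1, by
    have : (⟨((1 : P) : S), hP (1 : P).2⟩ : Q) = 1 := rfl
    rw [this, map_one]; rfl⟩
  mul_mem' := by
    rintro _ _ ⟨x, rfl⟩ ⟨y, rfl⟩
    refine ⟨x * y, ?_⟩
    have : (⟨((x * y : P) : S), hP (x * y).2⟩ : Q) = ⟨x, hP x.2⟩ * ⟨y, hP y.2⟩ := rfl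
    rw [this, map_mul]; rfl
  inv_mem' := by
    rintro _ ⟨x, rfl⟩
    refine ⟨x⁻¹, ?_⟩
    have : (⟨((x⁻¹ : P) : S), hP (x⁻¹).2⟩ : Q) = ⟨x, hP x.2⟩⁻¹ := rfl
    rw [this, map_inv]; rfl
  isClosed' := by
    have hc : Continuous (fun x : P => ((φ ⟨x, hP x.2⟩ : R) : S)) :=
      continuous_subtype_val.comp ((F.continuous_of_mem hφ).comp
        (continuous_subtype_val.subtype_mk _))
    exact (isCompact_range hc).isClosed

end

end ProFusionSystem

/-! ### `T`-subsystems -/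

/-- A `T`-subsystem `E` of the pro-fusion system `F`. -/
structure TSubsystem {p : ℕ} {S : Type u} [Group S] [TopologicalSpace S] [CompactSpace S]
    [T2Space S] (F : ProFusionSystem.{u, v, w} p S) (T : ClosedSubgroup S) where
  Hom : HomFamily S
  subset : ∀ P Q : ClosedSubgroup S, Hom P Q ⊆ F.Hom P Q
  id_mem : ∀ P : ClosedSubgroup S, MonoidHom.id P ∈ Hom P P
  comp_mem : ∀ {P Q R : ClosedSubgroup S} {ψ : Q →* R} {φ : P →* Q},
    ψ ∈ Hom Q R → φ ∈ Hom P Q → ψ.comp φ ∈ Hom P R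
  conj_mem : ∀ t ∈ T, ∀ (P Q : ClosedSubgroup S) (h : ∀ x ∈ P, t * x * t⁻¹ ∈ Q),
    conjHom t P Q h ∈ Hom P Q
  factor : ∀ {P Q : ClosedSubgroup S} {φ : P →* Q}, φ ∈ Hom P Q →
    ∃ (R : ClosedSubgroup S) (h : ∀ x ∈ R, x ∈ Q) (θ : P ≃* R),
      HomFamily.IsIso Hom θ ∧ φ = (inclHom R Q h).comp θ.toMonoidHom
  /-- `φ|_{P'} Hom_E(P, P') = Hom_E(φ(P), φ(P')) φ|_P` for `P, P' ≤ Q` and `φ ∈ Hom_F(Q, S)`. -/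
  invariant : ∀ (Q P P' : ClosedSubgroup S) (hP : P ≤ Q) (hP' : P' ≤ Q)
    (φ : Q →* wholeGroup S) (hφ : φ ∈ F.Hom Q (wholeGroup S)),
    {g : P → S | ∃ α ∈ Hom P P', ∀ x : P, g x = φ ⟨α x, hP' (α x).2⟩} =
    {g : P → S | ∃ β ∈ Hom (F.image φ hφ P hP) (F.image φ hφ P' hP'),
      ∀ x : P, g x = β ⟨φ ⟨x, hP x.2⟩, ⟨x, rfl⟩⟩}
  trivial_mod : ∀ (Q : ClosedSubgroup S), ∀ ψ ∈ Hom Q (wholeGroup S),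
    ∀ x : Q, (ψ x : S) * (x : S)⁻¹ ∈ T
  isClosed : ∀ P Q : ClosedSubgroup S, IsClosed {φ : F.Hom P Q | φ.1 ∈ Hom P Q}

/-! ### Groups of automorphisms -/

/-- `Aut_X(Q)`, the image of `N_X(Q)` in the group of automorphisms of `Q`. -/
def conjAut {S : Type u} [Group S] [TopologicalSpace S] (X : Subgroup S) (Q : ClosedSubgroup S) :
    Subgroup (MulAut Q) where
  carrier := {α | ∃ t ∈ X ⊓ Subgroup.normalizer (Q : Set S), ∀ x : Q, (α x : S) = t * x * t⁻¹}
  one_mem' := ⟨1, one_mem _, by simp⟩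
  mul_mem' := by
    rintro α β ⟨t, ht, hα⟩ ⟨s, hs, hβ⟩
    exact ⟨t * s, mul_mem ht hs, fun x => by simp [hα, hβ, mul_assoc]⟩
  inv_mem' := by
    rintro α ⟨t, ht, hα⟩
    refine ⟨t⁻¹, inv_mem ht, fun x => ?_⟩
    have h := hα (α⁻¹ x)
    rw [MulAut.apply_inv_self] at h
    rw [h]
    group

/-- `N_T(Q) Q`. -/
def normMul {S : Type u} [Group S] [TopologicalSpace S] [IsTopologicalGroup S] [CompactSpace S]
    [T2Space S] (T Q : ClosedSubgroup S) : ClosedSubgroup S where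
  toSubgroup := (T.toSubgroup ⊓ Subgroup.normalizer (Q : Set S)) ⊔ Q.toSubgroup
  isClosed' := by
    have hN : IsClosed ((Subgroup.normalizer (Q : Set S) : Subgroup S) : Set S) := by
      have : ((Subgroup.normalizer (Q : Set S) : Subgroup S) : Set S) =
          (⋂ x : Q, {g : S | g * x * g⁻¹ ∈ (Q : Set S)}) ∩
            ⋂ x : Q, {g : S | g⁻¹ * x * g ∈ (Q : Set S)} := by
        ext g
        simp only [SetLike.mem_coe, Set.mem_inter_iff, Set.mem_iInter,
          Set.mem_ofPred_eq]
        constructor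
        · intro h
          refine ⟨fun x => (h x).1 x.2, fun x => (h _).2 ?_⟩
          have : g * (g⁻¹ * x * g) * g⁻¹ = (x : S) := by group
          rw [this]; exact x.2
        · rintro ⟨h1, h2⟩ n
          refine ⟨fun hn => h1 ⟨n, hn⟩, fun hn => ?_⟩
          have h3 := h2 ⟨_, hn⟩
          have e : g⁻¹ * (g * n * g⁻¹) * g = n := by group
          rw [← e]
          exact h3
      rw [this]
      have hQ : IsClosed (Q : Set S) := Q.isClosed'
      exact (isClosed_iInter fun x => hQ.preimage (by fun_prop)).inter
        (isClosed_iInter fun x => hQ.preimage (by fun_prop))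
    have hle : T.toSubgroup ⊓ Subgroup.normalizer (Q : Set S) ≤
        Subgroup.normalizer (Q.toSubgroup : Set S) := inf_le_right
    change IsClosed (((T.toSubgroup ⊓ Subgroup.normalizer (Q : Set S)) ⊔ Q.toSubgroup :
      Subgroup S) : Set S)
    rw [Subgroup.coe_mul_of_left_le_normalizer_right _ _ hle]
    have hA : IsClosed ((T.toSubgroup ⊓ Subgroup.normalizer (Q : Set S) : Subgroup S) : Set S) :=
      T.isClosed'.inter hN
    exact (hA.isCompact.mul Q.isClosed'.isCompact).isClosed

theorem normMul_conj_mem {S : Type u} [Group S] [TopologicalSpace S] [IsTopologicalGroup S]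
    [CompactSpace S] [T2Space S] {T Q : ClosedSubgroup S} {x : S} (hx : x ∈ normMul T Q) {u : S}
    (hu : u ∈ Q) : x * u * x⁻¹ ∈ Q := by
  have hle : (normMul T Q).toSubgroup ≤ Subgroup.normalizer (Q : Set S) :=
    sup_le inf_le_right (Subgroup.le_normalizer (H := Q.toSubgroup))
  exact (Subgroup.mem_normalizer_iff.1 (hle hx) u).1 hu

namespace TSubsystem

section

variable {p : ℕ} {S : Type u} [Group S] [TopologicalSpace S] [IsTopologicalGroup S]
  [CompactSpace S] [T2Space S] {F : ProFusionSystem.{u, v, w} p S} {T : ClosedSubgroup S}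
  (E : TSubsystem F T)

/-- `Aut_E(Q)`. -/
def aut (Q : ClosedSubgroup S) : Subgroup (MulAut Q) where
  carrier := {α | HomFamily.IsIso E.Hom α}
  one_mem' := ⟨E.id_mem Q, E.id_mem Q⟩
  mul_mem' := fun ha hb => ⟨E.comp_mem ha.1 hb.1, E.comp_mem hb.2 ha.2⟩
  inv_mem' := fun ha => ⟨ha.2, ha.1⟩

/-- An element of `Aut_E(Q)` as an element of `Hom_F(Q, Q)`. -/
def autToHom (Q : ClosedSubgroup S) (α : E.aut Q) : F.Hom Q Q :=
  ⟨α.1.toMonoidHom, E.subset Q Q α.2.1⟩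

/-- The topology of the profinite group `Aut_E(Q)`, induced from `Hom_F(Q, Q)`. -/
instance autTopology (Q : ClosedSubgroup S) : TopologicalSpace (E.aut Q) :=
  TopologicalSpace.induced (E.autToHom Q) inferInstance

/-- `Aut_X(Q)` as a subgroup of `Aut_E(Q)`, for `X ≤ T`. -/
def innerAut (X : Subgroup S) (Q : ClosedSubgroup S) : Subgroup (E.aut Q) :=
  (conjAut X Q).subgroupOf (E.aut Q)

theorem conjAut_le_aut (Q : ClosedSubgroup S) : conjAut T.toSubgroup Q ≤ E.aut Q := by
  have key : ∀ α ∈ conjAut T.toSubgroup Q, MulEquiv.toMonoidHom α ∈ E.Hom Q Q := by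
    rintro α ⟨t, ht, h⟩
    have h' : ∀ x ∈ Q, t * x * t⁻¹ ∈ Q := fun x hx =>
      (Subgroup.mem_normalizer_iff.1 ht.2 x).1 hx
    have e : MulEquiv.toMonoidHom α = conjHom t Q Q h' := by
      ext x
      exact h x
    rw [e]
    exact E.conj_mem t ht.1 Q Q h'
  exact fun α hα => ⟨key α hα, key α⁻¹ (inv_mem hα)⟩

/-- `Aut_{T ∩ Q}(Q)` is normal in `Aut_E(Q)`. -/
instance innerAut_normal (Q : ClosedSubgroup S) :
    (E.innerAut (T.toSubgroup ⊓ Q.toSubgroup) Q).Normal where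
  conj_mem := by
    rintro ⟨γ, hγ⟩ ⟨t, ⟨⟨htT, htQ⟩, -⟩, ht⟩ ⟨α, hα⟩
    have hin : (inclHom Q (wholeGroup S) fun _ _ => trivial).comp (MulEquiv.toMonoidHom α) ∈
        E.Hom Q (wholeGroup S) := by
      refine E.comp_mem ?_ hα.1
      have h := E.conj_mem 1 (one_mem T) Q (wholeGroup S) fun _ _ => trivial
      convert h using 1
      ext x
      simp [inclHom, conjHom]
    have hmod := E.trivial_mod Q _ hin ⟨t, htQ⟩
    have hT : ((α ⟨t, htQ⟩ : Q) : S) ∈ T := by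
      have h2 := mul_mem hmod htT
      simpa [inclHom] using h2
    have hQ : ((α ⟨t, htQ⟩ : Q) : S) ∈ Q := (α ⟨t, htQ⟩).2
    refine ⟨(α ⟨t, htQ⟩ : Q), ⟨⟨hT, hQ⟩, Subgroup.le_normalizer (H := Q.toSubgroup) hQ⟩,
      fun x => ?_⟩
    change ((α (γ (α⁻¹ x)) : Q) : S) = _
    have e : γ (α⁻¹ x) = ⟨t, htQ⟩ * α⁻¹ x * ⟨t, htQ⟩⁻¹ := Subtype.ext (ht (α⁻¹ x))
    rw [e, map_mul, map_mul, map_inv, MulAut.apply_inv_self]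
    rfl

/-- `N^T_φ`, the group of all `x ∈ N_T(R) R` for which there is `y ∈ N_T(Q) Q` such that
`φ(x u x⁻¹) = y φ(u) y⁻¹` for all `u ∈ R`. -/
def extDomain {R Q : ClosedSubgroup S} (φ : R ≃* Q) (hφ : HomFamily.IsIso E.Hom φ) :
    ClosedSubgroup S where
  carrier := {x | ∃ hx : x ∈ normMul T R, ∃ y ∈ normMul T Q, ∀ u : R,
    (φ ⟨x * u * x⁻¹, normMul_conj_mem hx u.2⟩ : S) = y * φ u * y⁻¹}
  one_mem' := ⟨one_mem _, 1, one_mem _, fun u => by simp⟩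
  mul_mem' := by
    rintro a b ⟨ha, y, hy, h⟩ ⟨hb, z, hz, h'⟩
    refine ⟨mul_mem ha hb, y * z, mul_mem hy hz, fun u => ?_⟩
    have h1 := h ⟨b * u * b⁻¹, normMul_conj_mem hb u.2⟩
    rw [h' u] at h1
    have e : (⟨a * b * u * (a * b)⁻¹, normMul_conj_mem (mul_mem ha hb) u.2⟩ : R) =
        ⟨a * (b * u * b⁻¹) * a⁻¹, normMul_conj_mem ha (normMul_conj_mem hb u.2)⟩ :=
      Subtype.ext (by simp only [mul_assoc, mul_inv_rev])
    rw [e]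
    refine h1.trans ?_
    simp only [mul_assoc, mul_inv_rev]
  inv_mem' := by
    rintro a ⟨ha, y, hy, h⟩
    refine ⟨inv_mem ha, y⁻¹, inv_mem hy, fun u => ?_⟩
    have h1 := h ⟨a⁻¹ * u * a⁻¹⁻¹, normMul_conj_mem (inv_mem ha) u.2⟩
    have e : (⟨a * (a⁻¹ * u * a⁻¹⁻¹) * a⁻¹,
        normMul_conj_mem ha (normMul_conj_mem (inv_mem ha) u.2)⟩ : R) = u :=
      Subtype.ext (by simp only [inv_inv]; group)
    rw [e] at h1
    rw [h1]
    group
  isClosed' := by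
    have hc : Continuous φ := F.continuous_of_mem (E.subset _ _ hφ.1)
    let K : Set (normMul T R × normMul T Q) := {z | ∀ u : R,
      (φ ⟨z.1 * u * (z.1 : S)⁻¹, normMul_conj_mem z.1.2 u.2⟩ : S) = z.2 * φ u * (z.2 : S)⁻¹}
    have hK : IsClosed K := by
      have : K = ⋂ u : R, {z : normMul T R × normMul T Q |
        (φ ⟨z.1 * u * (z.1 : S)⁻¹, normMul_conj_mem z.1.2 u.2⟩ : S) =
          z.2 * φ u * (z.2 : S)⁻¹} := by
        ext z
        simp [K]
      rw [this]
      refine isClosed_iInter fun u => isClosed_eq ?_ (by fun_prop)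
      exact continuous_subtype_val.comp
        (hc.comp (Continuous.subtype_mk (by fun_prop) _))
    have hI : IsClosed ((fun z : normMul T R × normMul T Q => (z.1 : S)) '' K) :=
      (hK.isCompact.image (by fun_prop)).isClosed
    convert hI using 1
    ext x
    constructor
    · rintro ⟨hx, y, hy, h⟩
      exact ⟨(⟨x, hx⟩, ⟨y, hy⟩), h, rfl⟩
    · rintro ⟨⟨⟨x, hx⟩, ⟨y, hy⟩⟩, h, rfl⟩
      exact ⟨hx, y, hy, h⟩

end

end TSubsystem

/-! ### Pro-`p` groups, Sylow pro-`p` subgroups, posets of `p`-subgroups -/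

/-- The profinite group `G` is a pro-`p` group. -/
def IsProP (p : ℕ) (G : Type*) [Group G] [TopologicalSpace G] : Prop :=
  ∀ N : Subgroup G, N.Normal → IsOpen (N : Set G) → ∃ k : ℕ, N.index = p ^ k

/-- `H` is a Sylow pro-`p` subgroup of the profinite group `G`: a closed pro-`p` subgroup whose
(supernatural) index is prime to `p`. -/
def IsSylowProP (p : ℕ) {G : Type*} [Group G] [TopologicalSpace G] (H : Subgroup G) : Prop :=
  IsClosed (H : Set G) ∧ IsProP p H ∧
    ∀ U : Subgroup G, IsOpen (U : Set G) → H ≤ U → ¬ p ∣ U.index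

/-- The set `S_p(G)` of non-trivial (closed, pro-)`p`-subgroups of the profinite group `G`, ordered
by inclusion. -/
def SpPoset (p : ℕ) (G : Type*) [Group G] [TopologicalSpace G] : Type _ :=
  {H : Subgroup G // IsClosed (H : Set G) ∧ IsProP p H ∧ H ≠ ⊥}

instance (p : ℕ) (G : Type*) [Group G] [TopologicalSpace G] : PartialOrder (SpPoset p G) :=
  inferInstanceAs (PartialOrder {H : Subgroup G // IsClosed (H : Set G) ∧ IsProP p H ∧ H ≠ ⊥})

/-- The poset `X` is connected: it is non-empty, and any two elements are joined by a finite
sequence of elements in which neighbours are comparable. -/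
def PosetConnected (X : Type*) [PartialOrder X] : Prop :=
  Nonempty X ∧ ∀ a b : X, Relation.EqvGen (· ≤ ·) a b

/-! ### Saturation and essential subgroups -/

namespace TSubsystem

section

variable {p : ℕ} {S : Type u} [Group S] [TopologicalSpace S] [IsTopologicalGroup S]
  [CompactSpace S] [T2Space S] {F : ProFusionSystem.{u, v, w} p S} {T : ClosedSubgroup S}
  (E : TSubsystem F T)

/-- `Q` is receptive in `E`: every `φ ∈ Iso_E(R, Q)` extends to a morphism `N^T_φ → N_T(Q) Q`. -/
def Receptive (Q : ClosedSubgroup S) : Prop :=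
  ∀ (R : ClosedSubgroup S) (φ : R ≃* Q) (hφ : HomFamily.IsIso E.Hom φ),
    ∃ ψ ∈ E.Hom (E.extDomain φ hφ) (normMul T Q),
      ∀ (x : E.extDomain φ hφ) (hx : (x : S) ∈ R), (ψ x : S) = φ ⟨x, hx⟩

/-- `Q` is fully normalized in `E`. -/
def FullyNormalized (Q : ClosedSubgroup S) : Prop :=
  E.Receptive Q ∧ IsSylowProP p (E.innerAut T.toSubgroup Q)

/-- `Q` and `Q'` lie in the same `E`-isomorphism class. -/
def Isomorphic (Q Q' : ClosedSubgroup S) : Prop :=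
  ∃ θ : Q ≃* Q', HomFamily.IsIso E.Hom θ

/-- `E` is saturated. -/
def Saturated : Prop :=
  ∀ Q : ClosedSubgroup S, ∃ Q' : ClosedSubgroup S, E.Isomorphic Q Q' ∧ E.FullyNormalized Q'

/-- `Q` is `E`-centric: `C_T(Q') ≤ Z(Q')` for all `Q'` in the `E`-isomorphism class of `Q`. -/
def Centric (Q : ClosedSubgroup S) : Prop :=
  ∀ Q' : ClosedSubgroup S, E.Isomorphic Q Q' →
    T.toSubgroup ⊓ Subgroup.centralizer (Q' : Set S) ≤
      (Subgroup.center Q'.toSubgroup).map Q'.toSubgroup.subtype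

/-- `Q` is `E`-essential. -/
def Essential (Q : ClosedSubgroup S) : Prop :=
  T ≤ Q ∨ (E.Centric Q ∧
    ¬ PosetConnected
      (SpPoset p (E.aut Q ⧸ E.innerAut (T.toSubgroup ⊓ Q.toSubgroup) Q)))

end

end TSubsystem

/-!
Induct on the index of `P`. In the `E`-isomorphism class of `P` there is a fully normalized subgroup
`Q`, and since `φ` is the composite of an isomorphism `P → Q` and the inverse of an isomorphism
`P' → Q`, it suffices to decompose the isomorphisms `χ : P → Q` and the automorphisms of `Q` in `E`.
An isomorphism that extends to a properly larger subgroup decomposes by induction, as that subgroup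
has smaller index.

If `T ≤ P`, then `Q = P`, because `χ(u) u⁻¹ ∈ T ≤ P`. Otherwise `N_T(P)` is not contained in `P`,
because some term of the lower central series of `S` is. By Sylow's theorem in `Aut_E(Q)`, after
composing `χ` with an automorphism of `Q` the `p`-group `Aut_T(P)` is carried into `Aut_T(Q)`; then
`χ` extends over `N_T(P)`, as `Q` is receptive.

There remain the automorphisms of a fully normalized `Q` that is not essential. If `Q` is not
centric, then some element of `C_T(Q)` lies outside `Q`, and every automorphism of `Q` extends over
`C_T(Q)`. If `Q` is centric, then `S_p(Aut_E(Q) / Aut_{T ∩ Q}(Q))` is connected, which forces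
`Aut_E(Q)` to be generated by the automorphisms that conjugate some element of `Aut_T(Q)` outside
`Aut_{T ∩ Q}(Q)` back into `Aut_T(Q)`; each of these extends to a larger subgroup.
-/

open Topology
open scoped commutatorElement

theorem exists_mem_normalizer_notMem {G : Type*} [Group G] {P T : Subgroup G} [T.Normal] {n : ℕ}
    (hP : (⊤ : Subgroup G).lowerCentralSeries n ≤ P) (hTP : ¬ T ≤ P) :
    ∃ t ∈ T, t ∈ Subgroup.normalizer (P : Set G) ∧ t ∉ P := by
  classical
  have hex : ∃ k, T ⊓ (⊤ : Subgroup G).lowerCentralSeries k ≤ P := ⟨n, inf_le_right.trans hP⟩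
  obtain ⟨m, hm⟩ : ∃ m, Nat.find hex = m + 1 := by
    refine Nat.exists_eq_succ_of_ne_zero fun h0 => hTP ?_
    simpa [h0] using Nat.find_spec hex
  have hsucc : T ⊓ (⊤ : Subgroup G).lowerCentralSeries (m + 1) ≤ P := hm ▸ Nat.find_spec hex
  obtain ⟨t, ⟨htT, htm⟩, htP⟩ := SetLike.not_le_iff_exists.1
    (Nat.find_min hex (m := m) (by omega))
  have hcomm : ∀ x : G, ⁅t, x⁆ ∈ P := fun x =>
    hsucc ⟨Subgroup.commutator_le_left T ⊤ (Subgroup.commutator_mem_commutator htT trivial),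
      Subgroup.commutator_mem_commutator htm trivial⟩
  refine ⟨t, htT, Subgroup.mem_normalizer_iff.2 fun x => ?_, htP⟩
  have hconj : t * x * t⁻¹ = ⁅t, x⁆ * x := by simp [commutatorElement_def]
  rw [hconj]
  exact (Subgroup.mul_mem_cancel_left P (hcomm x)).symm

section ProP

variable {p : ℕ} {G : Type*} [Group G]

theorem exists_conj_mem_of_not_dvd_index [Fact p.Prime] {U Y : Subgroup G} (hU : ¬ p ∣ U.index)
    (hY : ∀ y ∈ Y, ∃ k : ℕ, y ^ p ^ k ∈ U.normalCore) : ∃ g : G, ∀ y ∈ Y, g⁻¹ * y * g ∈ U := by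
  have hYp : IsPGroup p (Y.map (MulAction.toPermHom G (G ⧸ U))) := by
    rintro ⟨_, y, hy, rfl⟩
    obtain ⟨k, hk⟩ := hY y hy
    rw [Subgroup.normalCore_eq_ker, MonoidHom.mem_ker, map_pow] at hk
    exact ⟨k, Subtype.ext hk⟩
  obtain ⟨a, ha⟩ := hYp.nonempty_fixed_point_of_prime_not_dvd_card (G ⧸ U) hU
  obtain ⟨g, rfl⟩ := QuotientGroup.mk_surjective a
  refine ⟨g, fun y hy => ?_⟩
  have hfix : ((y * g : G) : G ⧸ U) = g := ha ⟨_, Subgroup.mem_map_of_mem _ hy⟩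
  rw [mul_assoc]
  exact QuotientGroup.eq.1 hfix.symm

variable [TopologicalSpace G]

variable (p) in
/-- `g` is a pro-`p` element of `G`: its image in every quotient of `G` by an open normal subgroup
has `p`-power order. For closed `X ≤ G` this lets one work with the elements of `X` inside `G`,
instead of with the quotients of `X` that occur in `IsProP`. -/
def IsProPElement (g : G) : Prop :=
  ∀ U : Subgroup G, U.Normal → IsOpen (U : Set G) → ∃ k : ℕ, g ^ p ^ k ∈ U

theorem IsProP.isProPElement {X : Subgroup G} (hX : IsProP p X) {x : G} (hx : x ∈ X) :
    IsProPElement p x := by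
  intro U hU hUo
  obtain ⟨k, hk⟩ := hX (U.subgroupOf X) inferInstance (hUo.preimage continuous_subtype_val)
  exact ⟨k, hk ▸ (U.subgroupOf X).pow_index_mem ⟨x, hx⟩⟩

theorem IsProPElement.map {H : Type*} [Group H] [TopologicalSpace H] {g : G}
    (hg : IsProPElement p g) {f : G →* H} (hf : Continuous f) : IsProPElement p (f g) := by
  intro U hU hUo
  obtain ⟨k, hk⟩ := hg (U.comap f) (hU.comap f) (hUo.preimage hf)
  exact ⟨k, by simpa using hk⟩

theorem IsProPElement.of_mk [ContinuousMul G] {N : Subgroup G} [N.Normal]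
    (hN : ∀ x ∈ N, IsProPElement p x) {y : G} (hy : IsProPElement p (y : G ⧸ N)) :
    IsProPElement p y := by
  intro U hU hUo
  obtain ⟨k, u, hu, huy⟩ := hy (U.map (QuotientGroup.mk' N))
    (hU.map _ (QuotientGroup.mk'_surjective N)) (QuotientGroup.isOpenMap_coe _ hUo)
  obtain ⟨l, hl⟩ := hN _ (QuotientGroup.eq.1 (huy : (u : G ⧸ N) = (y ^ p ^ k : G))) U hU hUo
  refine ⟨k + l, ?_⟩
  rw [← QuotientGroup.eq_one_iff, QuotientGroup.mk_pow, QuotientGroup.mk_mul,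
    QuotientGroup.mk_inv, (QuotientGroup.eq_one_iff u).2 hu, inv_one, one_mul, QuotientGroup.mk_pow,
    ← pow_mul, ← pow_add] at hl
  rwa [← QuotientGroup.eq_one_iff, QuotientGroup.mk_pow]

theorem IsProP.map {H : Type*} [Group H] [TopologicalSpace H] {X : Subgroup G} (hX : IsProP p X)
    {f : G →* H} (hf : Continuous f) : IsProP p (X.map f) := by
  intro N hN hNo
  have hsurj : Function.Surjective (f.subgroupMap X) := f.subgroupMap_surjective X
  have hcont : Continuous (f.subgroupMap X) :=
    (hf.comp continuous_subtype_val).subtype_mk _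
  obtain ⟨k, hk⟩ := hX (N.comap (f.subgroupMap X)) (hN.comap _) (hNo.preimage hcont)
  exact ⟨k, by rwa [Subgroup.index_comap_of_surjective _ hsurj] at hk⟩

theorem IsSylowProP.exists_conj_mem [Fact p.Prime] [IsTopologicalGroup G] [CompactSpace G]
    [TotallyDisconnectedSpace G] {X Y : Subgroup G} (hX : IsSylowProP p X)
    (hY : ∀ y ∈ Y, IsProPElement p y) : ∃ g : G, ∀ y ∈ Y, g⁻¹ * y * g ∈ X := by
  let conjugators (U : OpenSubgroup G) : Set G := {g | ∀ y ∈ Y, g⁻¹ * y * g ∈ U}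
  have hclosed (U : OpenSubgroup G) : IsClosed (conjugators U) := by
    simp only [conjugators, Set.ofPred_forall]
    exact isClosed_iInter fun y => isClosed_iInter fun _ => U.isClosed.preimage (by fun_prop)
  have hne (U : {U : OpenSubgroup G // X ≤ U}) : (conjugators U).Nonempty := by
    have hcore : IsOpen (U.1.toSubgroup.normalCore : Set G) := by
      have := U.1.toSubgroup.quotient_finite_of_isOpen U.1.isOpen
      have := U.1.toSubgroup.finiteIndex_of_finite_quotient
      exact Subgroup.isOpen_of_isClosed_of_finiteIndex _
        (U.1.toSubgroup.normalCore_isClosed U.1.isClosed)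
    exact exists_conj_mem_of_not_dvd_index (hX.2.2 _ U.1.isOpen U.2)
      fun y hy => hY y hy _ inferInstance hcore
  have hdir : Directed (· ⊇ ·) fun U : {U : OpenSubgroup G // X ≤ U} => conjugators U :=
    fun U V => ⟨⟨U ⊓ V, le_inf U.2 V.2⟩, fun g hg y hy => (hg y hy).1, fun g hg y hy => (hg y hy).2⟩
  have : Nonempty {U : OpenSubgroup G // X ≤ U} := ⟨⟨⊤, le_top⟩⟩
  obtain ⟨g, hg⟩ := IsCompact.nonempty_iInter_of_directed_nonempty_isCompact_isClosed _ hdir hne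
    (fun U => (hclosed U).isCompact) fun U => hclosed U
  refine ⟨g, fun y hy => ?_⟩
  have hX_eq := ProfiniteGrp.closedSubgroup_eq_sInf_open ⟨X, hX.1⟩
  change X = _ at hX_eq
  rw [hX_eq, Subgroup.mem_sInf]
  exact fun U hU => Set.mem_iInter.1 hg ⟨⟨U, hU.1⟩, hU.2⟩ y hy

section Connected

variable {N X : Subgroup G} [N.Normal]

omit [TopologicalSpace G] in
theorem mk_mem_map_conj_iff (hNX : N ≤ X) {γ y : G} :
    (y : G ⧸ N) ∈ X.map ((QuotientGroup.mk' N).comp (MulAut.conj γ).toMonoidHom) ↔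
      γ⁻¹ * y * γ ∈ X := by
  constructor
  · rintro ⟨x, hx, hxy⟩
    have hN : γ * x⁻¹ * γ⁻¹ * y ∈ N := by
      simpa [mul_assoc] using QuotientGroup.eq.1 (hxy : ((γ * x * γ⁻¹ : G) : G ⧸ N) = y)
    have hconj := hNX (‹N.Normal›.conj_mem _ hN γ⁻¹)
    simpa [mul_assoc] using mul_mem hx hconj
  · exact fun hx => ⟨_, hx, by simp [mul_assoc]⟩

omit [TopologicalSpace G] in
theorem conj_notMem {y : G} (hy : y ∉ N) (g : G) : g⁻¹ * y * g ∉ N := fun h =>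
  hy (by simpa [mul_assoc] using ‹N.Normal›.conj_mem _ h g)

theorem SpPoset.exists_mk_mem_notMem (A : SpPoset p (G ⧸ N)) :
    ∃ y : G, (y : G ⧸ N) ∈ A.1 ∧ y ∉ N := by
  obtain ⟨⟨a, ha⟩, ha1⟩ := Subgroup.ne_bot_iff_exists_ne_one.1 A.2.2.2
  obtain ⟨y, rfl⟩ := QuotientGroup.mk_surjective a
  exact ⟨y, ha, fun hy => ha1 (Subtype.ext ((QuotientGroup.eq_one_iff y).2 hy))⟩

/-- For `N < X`, the conjugate of `X / N` by the image of `γ`, as a point of `S_p(G / N)`. -/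
def IsSylowProP.conjQuotient [IsTopologicalGroup G] (hX : IsSylowProP p X) (hNX : N < X) (γ : G) :
    SpPoset p (G ⧸ N) where
  val := X.map ((QuotientGroup.mk' N).comp (MulAut.conj γ).toMonoidHom)
  property := by
    refine ⟨?_, hX.2.1.map ?_, fun hbot => ?_⟩
    · rw [← (QuotientGroup.isQuotientMap_mk (N := N)).isClosed_preimage]
      have hpre : (QuotientGroup.mk : G → G ⧸ N) ⁻¹'
          (X.map ((QuotientGroup.mk' N).comp (MulAut.conj γ).toMonoidHom) : Set (G ⧸ N)) =
          (fun y => γ⁻¹ * y * γ) ⁻¹' X := by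
        ext y
        exact mk_mem_map_conj_iff hNX.le
      rw [hpre]
      exact hX.1.preimage (by fun_prop)
    · exact continuous_quot_mk.comp
        (by fun_prop : Continuous fun x : G => γ * x * γ⁻¹)
    · obtain ⟨x, hx, hxN⟩ := SetLike.exists_of_lt hNX
      have hmem := (mk_mem_map_conj_iff hNX.le (γ := γ) (y := γ * x * γ⁻¹)).2
        (by simpa [mul_assoc] using hx)
      rw [hbot, Subgroup.mem_bot, QuotientGroup.eq_one_iff] at hmem
      exact hxN (by simpa [mul_assoc] using ‹N.Normal›.conj_mem _ hmem γ⁻¹)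

variable [Fact p.Prime] [IsTopologicalGroup G] [CompactSpace G] [TotallyDisconnectedSpace G]

theorem IsSylowProP.exists_conj_preimage_mem (hX : IsSylowProP p X) (hNX : N ≤ X)
    (A : SpPoset p (G ⧸ N)) : ∃ g : G, ∀ y : G, (y : G ⧸ N) ∈ A.1 → g⁻¹ * y * g ∈ X :=
  hX.exists_conj_mem (Y := A.1.comap (QuotientGroup.mk' N)) fun _ hy =>
    .of_mk (fun _ hx => hX.2.1.isProPElement (hNX hx)) (A.2.2.1.isProPElement hy)

theorem IsSylowProP.inv_mul_mem_of_eqvGen (hX : IsSylowProP p X) (hNX : N ≤ X) {H : Subgroup G}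
    (hH : ∀ x ∈ X, x ∉ N → ∀ γ : G, γ * x * γ⁻¹ ∈ X → γ ∈ H) {A B : SpPoset p (G ⧸ N)}
    (hAB : Relation.EqvGen (· ≤ ·) A B) : ∀ {g h : G},
      (∀ y : G, (y : G ⧸ N) ∈ A.1 → g⁻¹ * y * g ∈ X) →
      (∀ y : G, (y : G ⧸ N) ∈ B.1 → h⁻¹ * y * h ∈ X) → h⁻¹ * g ∈ H := by
  have hle {A B : SpPoset p (G ⧸ N)} (hAB : A ≤ B) {g h : G}
      (hg : ∀ y : G, (y : G ⧸ N) ∈ A.1 → g⁻¹ * y * g ∈ X)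
      (hh : ∀ y : G, (y : G ⧸ N) ∈ B.1 → h⁻¹ * y * h ∈ X) : h⁻¹ * g ∈ H := by
    obtain ⟨y, hyA, hyN⟩ := A.exists_mk_mem_notMem
    exact hH _ (hg y hyA) (conj_notMem hyN g) _ (by simpa [mul_assoc] using hh y (hAB hyA))
  induction hAB with
  | rel _ _ hAB => exact hle hAB
  | refl _ => exact hle le_rfl
  | symm _ _ _ ih => exact fun hg hh => by simpa using inv_mem (ih hh hg)
  | trans _ C _ _ _ ih₁ ih₂ =>
    intro g h hg hh
    obtain ⟨c, hc⟩ := hX.exists_conj_preimage_mem hNX C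
    simpa [mul_assoc] using mul_mem (ih₂ hc hh) (ih₁ hg hc)

/- If `g` conjugates the preimage of `A` into `X`, then the coset `g H` depends only on `A`, and it
does not change when `A` is replaced by a larger or smaller subgroup. As `S_p(G / N)` is connected,
the coset is the same for `X / N` and its conjugate by `γ`, where it is `H` and `γ H`. -/
theorem IsSylowProP.eq_top_of_posetConnected (hX : IsSylowProP p X) (hNX : N ≤ X)
    (hconn : PosetConnected (SpPoset p (G ⧸ N))) {H : Subgroup G}
    (hH : ∀ x ∈ X, x ∉ N → ∀ γ : G, γ * x * γ⁻¹ ∈ X → γ ∈ H) : H = ⊤ := by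
  have hlt : N < X := by
    obtain ⟨A⟩ := hconn.1
    obtain ⟨y, hyA, hyN⟩ := A.exists_mk_mem_notMem
    obtain ⟨g, hg⟩ := hX.exists_conj_preimage_mem hNX A
    exact SetLike.lt_iff_le_and_exists.2 ⟨hNX, _, hg y hyA, conj_notMem hyN g⟩
  refine eq_top_iff.2 fun γ _ => ?_
  simpa using hX.inv_mul_mem_of_eqvGen hNX hH
    (hconn.2 (hX.conjQuotient hlt γ) (hX.conjQuotient hlt 1))
    (fun y hy => (mk_mem_map_conj_iff hNX).1 hy) (fun y hy => (mk_mem_map_conj_iff hNX).1 hy)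

end Connected

end ProP

namespace ProFusionSystem

section Proj

variable {p : ℕ} {S : Type u} [Group S] [TopologicalSpace S] (F : ProFusionSystem.{u, v, w} p S)

theorem map_proj {i j : F.sys.I} (hij : i ≤ j) (x : S) :
    F.sys.map hij (F.proj j x) = F.proj i x :=
  (F.iso x).2 i j hij

theorem proj_eq_of_le {i j : F.sys.I} (hij : i ≤ j) {x y : S} (h : F.proj j x = F.proj j y) :
    F.proj i x = F.proj i y := by
  rw [← F.map_proj hij, h, F.map_proj hij]

theorem eq_of_forall_proj {x y : S} (h : ∀ i, F.proj i x = F.proj i y) : x = y :=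
  F.iso.injective (Subtype.ext (funext h))

theorem exists_proj_fiber_subset {U : Set S} (hU : IsOpen U) {x : S} (hx : x ∈ U) :
    ∃ i, ∀ y, F.proj i y = F.proj i x → y ∈ U := by
  have hind : IsInducing fun y : S => ((F.iso y : F.sys.limit) : ∀ i, F.sys.S i) :=
    IsInducing.subtypeVal.comp F.iso.toHomeomorph.isInducing
  obtain ⟨V, hV, rfl⟩ := hind.isOpen_iff.1 hU
  obtain ⟨I₀, u, hu, hsub⟩ := isOpen_pi_iff.1 hV _ hx
  obtain ⟨i, hi⟩ := I₀.exists_le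
  refine ⟨i, fun y hy => hsub fun j hj => ?_⟩
  have h : F.proj j y = F.proj j x := F.proj_eq_of_le (hi j hj) hy
  change F.proj j y ∈ u j
  exact h ▸ (hu j hj).2

theorem mem_of_forall_proj {Q : Set S} (hQ : IsClosed Q) {x : S}
    (h : ∀ i, ∃ q ∈ Q, F.proj i q = F.proj i x) : x ∈ Q := by
  by_contra hx
  obtain ⟨i, hi⟩ := F.exists_proj_fiber_subset hQ.isOpen_compl hx
  obtain ⟨q, hq, hqx⟩ := h i
  exact hi q hqx hq

/-- The kernel of the projection `f_i`, as a closed subgroup of `S`. -/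
def kerProj (i : F.sys.I) : ClosedSubgroup S where
  toSubgroup := (F.proj i).ker
  isClosed' := (isClosed_discrete {1}).preimage (F.continuous_proj i)

theorem isOpen_kerProj (i : F.sys.I) : IsOpen (F.kerProj i : Set S) :=
  (isOpen_discrete {1}).preimage (F.continuous_proj i)

theorem exists_kerProj_le {P : Subgroup S} (hP : IsOpen (P : Set S)) :
    ∃ i, (F.kerProj i).toSubgroup ≤ P := by
  obtain ⟨i, hi⟩ := F.exists_proj_fiber_subset hP (one_mem P)
  exact ⟨i, fun y hy => hi y (hy.trans (map_one _).symm)⟩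

include F in
theorem exists_lowerCentralSeries_le [Fact p.Prime] {P : Subgroup S} (hP : IsOpen (P : Set S)) :
    ∃ n, (⊤ : Subgroup S).lowerCentralSeries n ≤ P := by
  obtain ⟨i, hi⟩ := F.exists_kerProj_le hP
  have : Group.IsNilpotent (F.sys.S i) := (F.sys.isPGroup i).isNilpotent
  obtain ⟨n, hn⟩ := Subgroup.nilpotent_iff_lowerCentralSeries.1 this
  refine ⟨n, le_trans (Subgroup.map_eq_bot_iff _ |>.1 (eq_bot_iff.2 ?_)) hi⟩
  rw [Subgroup.map_lowerCentralSeries, ← hn]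
  exact Subgroup.lowerCentralSeries_mono n le_top

end Proj

section Hom

variable {p : ℕ} {S : Type u} [Group S] [TopologicalSpace S] {F : ProFusionSystem.{u, v, w} p S}
  {P Q : ClosedSubgroup S}

theorem proj_apply_eq_iff {φ : P →* Q} (hφ : φ ∈ F.Hom P Q) {i : F.sys.I} {x y : P} :
    F.proj i (φ x : Q) = F.proj i (φ y : Q) ↔ F.proj i x = F.proj i y := by
  obtain ⟨ψ, hmem, hψ⟩ := hφ i
  rw [← hψ, ← hψ, SetLike.coe_eq_coe, ((F.sys.fusion i).injective hmem).eq_iff, Subtype.mk_eq_mk]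

theorem exists_induces_of_compatible
    {ψ : ∀ i, P.toSubgroup.map (F.proj i) →* Q.toSubgroup.map (F.proj i)}
    (hψ : ∀ i, ψ i ∈ (F.sys.fusion i).Hom _ _)
    (hcompat : ∀ (i j : F.sys.I) (hij : i ≤ j) (x : P),
      F.sys.map hij (ψ j ⟨F.proj j x, Subgroup.mem_map_of_mem _ x.2⟩) =
        (ψ i ⟨F.proj i x, Subgroup.mem_map_of_mem _ x.2⟩ : F.sys.S i)) :
    ∃ φ ∈ F.Hom P Q, ∀ i, FusionSystem.Induces (P := P.toSubgroup) (Q := Q.toSubgroup)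
      (F.proj i) φ (ψ i) := by
  let component (i : F.sys.I) : P →* F.sys.S i :=
    (Subgroup.subtype _).comp ((ψ i).comp ((F.proj i).subgroupMap P.toSubgroup))
  let toLimit : P →* F.sys.limit :=
    (MonoidHom.pi component).codRestrict F.sys.limit fun x i j hij => hcompat i j hij x
  let toS : P →* S := F.iso.symm.toMulEquiv.toMonoidHom.comp toLimit
  have hproj (i : F.sys.I) (x : P) : F.proj i (toS x) = component i x := by
    change (F.iso (F.iso.symm (toLimit x))).1 i = _
    rw [F.iso.apply_symm_apply]
    rfl
  have hmem (x : P) : toS x ∈ Q.toSubgroup := F.mem_of_forall_proj Q.isClosed' fun i => by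
    rw [hproj]
    exact (ψ i _).2
  exact ⟨toS.codRestrict Q.toSubgroup hmem, fun i => ⟨ψ i, hψ i, fun x => (hproj i x).symm⟩,
    fun i x => (hproj i x).symm⟩

theorem hasBasis_nhds_hom (φ : F.Hom P Q) :
    (𝓝 φ).HasBasis (fun _ : F.sys.I => True) fun i => {φ' : F.Hom P Q |
      ∀ x : P, F.proj i (φ'.1 x : Q) = F.proj i (φ.1 x : Q)} := by
  have hnhds : 𝓝 φ = ⨅ i, Filter.principal {φ' : F.Hom P Q |
      ∀ x : P, F.proj i (φ'.1 x : Q) = F.proj i (φ.1 x : Q)} := by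
    rw [nhds_iInf]
    refine iInf_congr fun i => ?_
    let _ : TopologicalSpace (P → F.sys.S i) := ⊥
    have : DiscreteTopology (P → F.sys.S i) := ⟨rfl⟩
    rw [nhds_induced, nhds_discrete, ← Filter.principal_singleton, Filter.comap_principal]
    congr 1
    ext φ'
    exact funext_iff
  rw [hnhds]
  refine Filter.hasBasis_iInf_principal fun i j => ?_
  obtain ⟨k, hik, hjk⟩ := exists_ge_ge i j
  exact ⟨k, fun φ' h x => F.proj_eq_of_le hik (h x), fun φ' h x => F.proj_eq_of_le hjk (h x)⟩

instance compactSpace_hom : CompactSpace (F.Hom P Q) := by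
  refine ⟨isCompact_iff_ultrafilter_le_nhds.2 fun 𝒰 _ => ?_⟩
  choose r hrmem hr using fun (φ : F.Hom P Q) (i : F.sys.I) => φ.2 i
  have hconst (i : F.sys.I) : ∃ ψ, ∀ᶠ φ in (𝒰 : Filter (F.Hom P Q)), r φ i = ψ := by
    have : Finite (P.toSubgroup.map (F.proj i) →* Q.toSubgroup.map (F.proj i)) :=
      Finite.of_injective _ DFunLike.coe_injective
    obtain ⟨ψ, hψ⟩ := (𝒰.map fun φ => r φ i).eq_pure_of_finite
    have hmem : ({ψ} : Set _) ∈ 𝒰.map fun φ => r φ i := by rw [hψ]; exact rfl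
    exact ⟨ψ, hmem⟩
  choose ψ hψ using hconst
  obtain ⟨φ, hφ, hind⟩ := exists_induces_of_compatible (F := F) (ψ := ψ)
    (fun i => (hψ i).exists.elim fun φ h => h ▸ hrmem φ i) fun i j hij x => by
      obtain ⟨φ, hi, hj⟩ := ((hψ i).and (hψ j)).exists
      rw [← hi, ← hj, hr, hr]
      exact F.map_proj hij _
  refine ⟨⟨φ, hφ⟩, trivial, (hasBasis_nhds_hom _).ge_iff.2 fun i _ => ?_⟩
  filter_upwards [hψ i] with φ' h x
  rw [← hr φ' i, h]
  exact hind i x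

instance totallyDisconnectedSpace_hom : TotallyDisconnectedSpace (F.Hom P Q) := by
  have hcont : Continuous fun (φ : F.Hom P Q) (x : P) (i : F.sys.I) => F.proj i (φ.1 x : Q) := by
    refine continuous_pi fun x => continuous_pi fun i => continuous_iff_continuousAt.2 fun φ => ?_
    rw [ContinuousAt, nhds_discrete (F.sys.S i), Filter.tendsto_pure]
    exact (hasBasis_nhds_hom φ).mem_iff.2 ⟨i, trivial, fun _ h => h x⟩
  refine ⟨isTotallyDisconnected_of_image hcont.continuousOn (fun φ φ' h => ?_)
    (isTotallyDisconnected_of_totallyDisconnectedSpace _)⟩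
  exact Subtype.ext (MonoidHom.ext fun x => Subtype.ext (F.eq_of_forall_proj (congrFun₂ h x)))

end Hom

section Image

variable {p : ℕ} {S : Type u} [Group S] [TopologicalSpace S] [CompactSpace S] [T2Space S]
  {F : ProFusionSystem.{u, v, w} p S} {P Q R : ClosedSubgroup S} {φ : Q →* R}

theorem card_map_proj_image (hφ : φ ∈ F.Hom Q R) (hP : P ≤ Q) (i : F.sys.I) :
    Nat.card ((F.image φ hφ P hP).toSubgroup.map (F.proj i)) =
      Nat.card (P.toSubgroup.map (F.proj i)) := by
  let f : P →* F.sys.S i := (F.proj i).comp P.toSubgroup.subtype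
  let g : P →* F.sys.S i :=
    (F.proj i).comp (R.toSubgroup.subtype.comp (φ.comp (Subgroup.inclusion hP)))
  have hf : P.toSubgroup.map (F.proj i) = f.range := by
    rw [MonoidHom.range_comp, Subgroup.range_subtype]
  have hg : (F.image φ hφ P hP).toSubgroup.map (F.proj i) = g.range := by
    rw [MonoidHom.range_comp]
    rfl
  have hker : g.ker = f.ker := by
    ext x
    have h := proj_apply_eq_iff hφ (i := i) (x := Subgroup.inclusion hP x) (y := 1)
    simp only [map_one, OneMemClass.coe_one] at h
    exact h
  rw [hf, hg, ← Subgroup.index_ker, ← Subgroup.index_ker, hker]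

/- A morphism cannot move a subgroup properly into itself, because `f_i(φ(P))` and `f_i(P)` have the
same finite order. -/
theorem image_eq_of_le (hφ : φ ∈ F.Hom Q R) (hP : P ≤ Q) (h : F.image φ hφ P hP ≤ P) :
    F.image φ hφ P hP = P := by
  refine le_antisymm h fun x hx => F.mem_of_forall_proj (F.image φ hφ P hP).isClosed' fun i => ?_
  have hmap : (F.image φ hφ P hP).toSubgroup.map (F.proj i) = P.toSubgroup.map (F.proj i) :=
    Subgroup.eq_of_le_of_card_ge (Subgroup.map_mono h) (card_map_proj_image hφ hP i).ge
  exact hmap.ge (Subgroup.mem_map_of_mem _ hx)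

theorem surjective_of_mem {φ : Q →* Q} (hφ : φ ∈ F.Hom Q Q) : Function.Surjective φ := by
  intro y
  have himage : F.image φ hφ Q le_rfl = Q := image_eq_of_le hφ le_rfl fun _ ⟨x, hx⟩ =>
    hx ▸ (φ x).2
  obtain ⟨x, hx⟩ := himage.ge y.2
  exact ⟨x, Subtype.ext hx⟩

theorem kerProj_le_of_mem (hφ : φ ∈ F.Hom Q R) {i : F.sys.I} (hQ : F.kerProj i ≤ Q) :
    F.kerProj i ≤ R := by
  have himage : F.image φ hφ (F.kerProj i) hQ = F.kerProj i := by
    refine image_eq_of_le hφ hQ ?_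
    rintro _ ⟨x, rfl⟩
    have h := (proj_apply_eq_iff hφ (i := i) (x := ⟨x, hQ x.2⟩) (y := 1)).2
    simp only [map_one, OneMemClass.coe_one] at h
    exact h x.2
  rw [← himage]
  rintro _ ⟨x, rfl⟩
  exact (φ _).2

theorem index_eq_of_surjective (hφ : φ ∈ F.Hom Q R) (hsurj : Function.Surjective φ)
    (hQ : IsOpen (Q : Set S)) : R.toSubgroup.index = Q.toSubgroup.index := by
  obtain ⟨i, hi⟩ := F.exists_kerProj_le (P := Q.toSubgroup) hQ
  have himage : F.image φ hφ Q le_rfl = R := by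
    refine SetLike.ext fun y => ⟨?_, fun hy => ?_⟩
    · rintro ⟨x, rfl⟩
      exact (φ x).2
    · exact (hsurj ⟨y, hy⟩).imp fun x hx => congrArg Subtype.val hx
  have hcard : (F.kerProj i).toSubgroup.relIndex R.toSubgroup =
      (F.kerProj i).toSubgroup.relIndex Q.toSubgroup := by
    change (F.proj i).ker.relIndex _ = (F.proj i).ker.relIndex _
    rw [Subgroup.relIndex_ker, Subgroup.relIndex_ker, ← card_map_proj_image hφ le_rfl i, himage]
  have hmul := Subgroup.relIndex_mul_index (kerProj_le_of_mem hφ hi)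
  rw [← Subgroup.relIndex_mul_index hi, hcard] at hmul
  refine Nat.eq_of_mul_eq_mul_left (Nat.pos_of_ne_zero ?_) hmul
  change (F.proj i).ker.relIndex _ ≠ 0
  rw [Subgroup.relIndex_ker]
  exact Nat.card_pos.ne'

theorem isOpen_of_mem [IsTopologicalGroup S] (hφ : φ ∈ F.Hom Q R) (hQ : IsOpen (Q : Set S)) :
    IsOpen (R : Set S) := by
  obtain ⟨i, hi⟩ := F.exists_kerProj_le (P := Q.toSubgroup) hQ
  exact Subgroup.isOpen_mono (kerProj_le_of_mem hφ hi) (F.isOpen_kerProj i)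

end Image

end ProFusionSystem

theorem conj_pow_apply {G A : Type*} [Group G] [SetLike A G] [SubgroupClass A G] {Q : A}
    {α : MulAut Q} {t : G} (hα : ∀ x : Q, (α x : G) = t * x * t⁻¹) (n : ℕ) (x : Q) :
    ((α ^ n) x : G) = t ^ n * x * (t ^ n)⁻¹ := by
  induction n with
  | zero => simp
  | succ n ih => rw [pow_succ', pow_succ', MulAut.mul_apply, hα, ih]; group

namespace TSubsystem

section

variable {p : ℕ} {S : Type u} [Group S] [TopologicalSpace S] [CompactSpace S] [T2Space S]
  {F : ProFusionSystem.{u, v, w} p S} {T : ClosedSubgroup S} {P Q R : ClosedSubgroup S}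

theorem inclHom_mem (E : TSubsystem F T) (h : ∀ x ∈ P, x ∈ Q) : inclHom P Q h ∈ E.Hom P Q := by
  convert E.conj_mem 1 (one_mem T) P Q (by simpa using h) using 1
  ext x
  simp [inclHom, conjHom]

/- Conjugation by `t ∈ T` belongs to `E`, so `(t s t⁻¹) s⁻¹ ∈ T` for all `s ∈ S`. -/
theorem normal (E : TSubsystem F T) : T.toSubgroup.Normal := by
  refine ⟨fun t ht s => ?_⟩
  have hcomm : t⁻¹ * s * t * s⁻¹ ∈ T := by
    simpa [conjHom] using E.trivial_mod _ _
      (E.conj_mem t⁻¹ (inv_mem ht) (wholeGroup S) (wholeGroup S) fun _ _ => trivial) ⟨s, trivial⟩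
  simpa [mul_assoc] using mul_mem ht hcomm

variable {E : TSubsystem F T}

theorem isIso_trans {φ : P ≃* Q} {ψ : Q ≃* R} (hφ : HomFamily.IsIso E.Hom φ)
    (hψ : HomFamily.IsIso E.Hom ψ) : HomFamily.IsIso E.Hom (φ.trans ψ) :=
  ⟨E.comp_mem hψ.1 hφ.1, E.comp_mem hφ.2 hψ.2⟩

theorem isIso_symm {φ : P ≃* Q} (hφ : HomFamily.IsIso E.Hom φ) : HomFamily.IsIso E.Hom φ.symm :=
  ⟨hφ.2, hφ.1⟩

theorem isIso_of_surjective {φ : P →* Q} (hφ : φ ∈ E.Hom P Q) (hsurj : Function.Surjective φ) :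
    ∃ θ : P ≃* Q, HomFamily.IsIso E.Hom θ ∧ θ.toMonoidHom = φ := by
  obtain ⟨R, hRQ, θ, hθ, rfl⟩ := E.factor hφ
  have hQR : Q ≤ R := fun x hx => by
    obtain ⟨y, hy⟩ := hsurj ⟨x, hx⟩
    have hyx : (θ y : S) = x := congrArg Subtype.val hy
    exact hyx ▸ (θ y).2
  obtain rfl : R = Q := le_antisymm hRQ hQR
  exact ⟨θ, hθ, rfl⟩

theorem injective_of_mem {φ : P →* Q} (hφ : φ ∈ E.Hom P Q) : Function.Injective φ := by
  obtain ⟨R, hRQ, θ, -, rfl⟩ := E.factor hφ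
  refine fun x y hxy => θ.injective (Subtype.ext ?_)
  simpa [inclHom] using congrArg Subtype.val hxy

theorem apply_mul_inv_mem {φ : P →* Q} (hφ : φ ∈ E.Hom P Q) (x : P) :
    (φ x : S) * (x : S)⁻¹ ∈ T :=
  E.trivial_mod P _ (E.comp_mem (E.inclHom_mem (Q := wholeGroup S) fun _ _ => trivial) hφ) x

theorem apply_mem {φ : P →* Q} (hφ : φ ∈ E.Hom P Q) {x : P} (hx : (x : S) ∈ T) :
    (φ x : S) ∈ T := by
  simpa using mul_mem (apply_mul_inv_mem hφ x) hx

end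

section Aut

variable {p : ℕ} {S : Type u} [Group S] [TopologicalSpace S] [CompactSpace S]
  [T2Space S] {F : ProFusionSystem.{u, v, w} p S} {T : ClosedSubgroup S} {E : TSubsystem F T}
  {Q R : ClosedSubgroup S}

theorem proj_aut_apply_eq_iff (γ : E.aut Q) {i : F.sys.I} {x y : Q} :
    F.proj i (γ.1 x) = F.proj i (γ.1 y) ↔ F.proj i x = F.proj i y :=
  ProFusionSystem.proj_apply_eq_iff (E.subset _ _ γ.2.1)

theorem hasBasis_nhds_aut (α : E.aut Q) :
    (𝓝 α).HasBasis (fun _ : F.sys.I => True)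
      fun i => {β : E.aut Q | ∀ x, F.proj i (β.1 x : Q) = F.proj i (α.1 x : Q)} := by
  rw [nhds_induced]
  exact (ProFusionSystem.hasBasis_nhds_hom (E.autToHom Q α)).comap _

instance isTopologicalGroup_aut : IsTopologicalGroup (E.aut Q) where
  continuous_mul := by
    refine continuous_iff_continuousAt.2 fun ⟨α, β⟩ => ?_
    rw [ContinuousAt, nhds_prod_eq, ((hasBasis_nhds_aut α).prod
      (hasBasis_nhds_aut β)).tendsto_iff (hasBasis_nhds_aut _)]
    exact fun i _ => ⟨(i, i), ⟨trivial, trivial⟩, fun ⟨α', _⟩ ⟨hα, hβ⟩ x =>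
      ((proj_aut_apply_eq_iff α').2 (hβ x)).trans (hα (β.1 x))⟩
  continuous_inv := by
    refine continuous_iff_continuousAt.2 fun α => ?_
    rw [ContinuousAt, (hasBasis_nhds_aut α).tendsto_iff (hasBasis_nhds_aut _)]
    refine fun i _ => ⟨i, trivial, fun β hβ x => (proj_aut_apply_eq_iff β).1 ?_⟩
    have hββ : β.1 ((β⁻¹).1 x) = x := MulAut.apply_inv_self _ _ _
    have hαα : α.1 ((α⁻¹).1 x) = x := MulAut.apply_inv_self _ _ _
    rw [hββ, hβ, hαα]

theorem isClosedEmbedding_autToHom : IsClosedEmbedding (E.autToHom Q) := by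
  refine ⟨⟨⟨rfl⟩, fun α β h => Subtype.ext (MulEquiv.ext fun x => ?_)⟩, ?_⟩
  · exact DFunLike.congr_fun (congrArg Subtype.val h) x
  · have hrange : Set.range (E.autToHom Q) = {φ : F.Hom Q Q | φ.1 ∈ E.Hom Q Q} := by
      refine Set.ext fun φ => ⟨?_, fun hφ => ?_⟩
      · rintro ⟨α, rfl⟩
        exact α.2.1
      · obtain ⟨θ, hθ, hθφ⟩ := isIso_of_surjective hφ (ProFusionSystem.surjective_of_mem φ.2)
        exact ⟨⟨θ, hθ⟩, Subtype.ext hθφ⟩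
    exact hrange ▸ E.isClosed Q Q

instance compactSpace_aut : CompactSpace (E.aut Q) :=
  isClosedEmbedding_autToHom.compactSpace

instance totallyDisconnectedSpace_aut : TotallyDisconnectedSpace (E.aut Q) :=
  ⟨isClosedEmbedding_autToHom.isEmbedding.isTotallyDisconnected
    (isTotallyDisconnected_of_totallyDisconnectedSpace _)⟩

/-- Transport of automorphisms along an isomorphism `χ : R → Q` of `E`. -/
def autCongr {χ : R ≃* Q} (hχ : HomFamily.IsIso E.Hom χ) : E.aut R →* E.aut Q :=
  ((MulAut.congr χ).toMonoidHom.comp (E.aut R).subtype).codRestrict (E.aut Q) fun γ =>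
    isIso_trans (isIso_symm hχ) (isIso_trans γ.2 hχ)

theorem continuous_autCongr {χ : R ≃* Q} (hχ : HomFamily.IsIso E.Hom χ) :
    Continuous (autCongr hχ) := by
  refine continuous_iff_continuousAt.2 fun α => ?_
  rw [ContinuousAt, (hasBasis_nhds_aut α).tendsto_iff (hasBasis_nhds_aut _)]
  exact fun i _ => ⟨i, trivial, fun β hβ x =>
    (ProFusionSystem.proj_apply_eq_iff (E.subset _ _ hχ.1)).2 (hβ (χ.symm x))⟩

theorem innerAut_mono {X Y : Subgroup S} (hXY : X ≤ Y) : E.innerAut X Q ≤ E.innerAut Y Q := by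
  rintro α ⟨t, ⟨htX, htQ⟩, hα⟩
  exact ⟨t, ⟨hXY htX, htQ⟩, hα⟩

theorem isProPElement_of_mem_innerAut {X : Subgroup S} {α : E.aut Q} (hα : α ∈ E.innerAut X Q) :
    IsProPElement p α := by
  intro U _ hUo
  obtain ⟨t, -, ht⟩ := hα
  obtain ⟨i, -, hi⟩ := (hasBasis_nhds_aut 1).mem_iff.1 (hUo.mem_nhds (one_mem U))
  obtain ⟨k, hk⟩ := F.sys.isPGroup i (F.proj i t)
  refine ⟨k, hi fun x => ?_⟩
  have hpow : ((α ^ p ^ k).1 x : S) = t ^ p ^ k * x * (t ^ p ^ k)⁻¹ := conj_pow_apply ht _ x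
  simp only [hpow, map_mul, map_inv, map_pow, hk, one_mul, inv_one, mul_one]
  rfl

end Aut

section Decomposes

variable {p : ℕ} {S : Type u} [Group S] [TopologicalSpace S] [IsTopologicalGroup S]
  [CompactSpace S] [T2Space S] {F : ProFusionSystem.{u, v, w} p S} {T : ClosedSubgroup S}
  {E : TSubsystem F T} {P P' Q Q' R : ClosedSubgroup S}

variable (E) in
/-- An automorphism in `E` of an open, `E`-essential and fully normalized subgroup of `S`: a factor
of the decompositions in Alperin's fusion theorem. -/
structure EssentialAut where
  domain : ClosedSubgroup S
  aut : E.aut domain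
  isOpen : IsOpen (domain : Set S)
  essential : E.Essential domain
  fullyNormalized : E.FullyNormalized domain

namespace EssentialAut

/-- The graph of `s`, as a relation on `S`. -/
def Rel (s : E.EssentialAut) (x y : S) : Prop :=
  ∃ hx : x ∈ s.domain, y = s.aut.1 ⟨x, hx⟩

/-- The inverse automorphism, on the same domain. -/
def inv (s : E.EssentialAut) : E.EssentialAut :=
  { s with aut := s.aut⁻¹ }

/-- `s` is defined on `P` and `s(P) = P'`. -/
def MapsOnto (s : E.EssentialAut) (P P' : ClosedSubgroup S) : Prop :=
  P ≤ s.domain ∧ P' ≤ s.domain ∧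
    ∀ y : S, y ∈ P' ↔ ∃ x : s.domain, (x : S) ∈ P ∧ (s.aut.1 x : S) = y

/-- The composite of the automorphisms in `l`, the head of `l` applied first, as a relation
on `S`. -/
def Chain : (l : List E.EssentialAut) → S → S → Prop
  | [] => Eq
  | s :: l => Relation.Comp s.Rel (Chain l)

variable {s : E.EssentialAut}

theorem Rel.unique {x y z : S} (hy : s.Rel x y) (hz : s.Rel x z) : y = z :=
  hy.2.trans hz.2.symm

theorem Rel.inv {x y : S} (h : s.Rel x y) : s.inv.Rel y x := by
  obtain ⟨hx, rfl⟩ := h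
  exact ⟨(s.aut.1 ⟨x, hx⟩).2, (congrArg Subtype.val (s.aut.1.symm_apply_apply ⟨x, hx⟩)).symm⟩

theorem mapsOnto_of_rel {θ : P ≃* P'} (hθ : ∀ u : P, s.Rel u (θ u)) : s.MapsOnto P P' := by
  refine ⟨fun x hx => (hθ ⟨x, hx⟩).1, fun y hy => ?_, fun y => ⟨fun hy => ?_, ?_⟩⟩
  · obtain ⟨hx, hy'⟩ := hθ (θ.symm ⟨y, hy⟩)
    rw [θ.apply_symm_apply] at hy'
    exact (congrArg (· ∈ s.domain) hy').mpr (s.aut.1 _).2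
  · obtain ⟨hx, hy'⟩ := hθ (θ.symm ⟨y, hy⟩)
    rw [θ.apply_symm_apply] at hy'
    exact ⟨⟨_, hx⟩, (θ.symm ⟨y, hy⟩).2, hy'.symm⟩
  · rintro ⟨x, hx, rfl⟩
    obtain ⟨_, hy⟩ := hθ ⟨x, hx⟩
    exact hy ▸ (θ ⟨x, hx⟩).2

theorem exists_isIso_rel (hP : P ≤ s.domain) :
    ∃ (P₁ : ClosedSubgroup S) (θ : P ≃* P₁), HomFamily.IsIso E.Hom θ ∧
      ∀ u : P, s.Rel u (θ u) := by
  obtain ⟨P₁, _, θ, hθ, hsθ⟩ := E.factor (E.comp_mem s.aut.2.1 (E.inclHom_mem hP))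
  exact ⟨P₁, θ, hθ, fun u =>
    ⟨hP u.2, (congrArg Subtype.val (DFunLike.congr_fun hsθ u)).symm⟩⟩

theorem Chain.append {l m : List E.EssentialAut} {x y z : S} (hl : Chain l x y)
    (hm : Chain m y z) : Chain (l ++ m) x z := by
  induction l generalizing x with
  | nil => exact (hl : x = y) ▸ hm
  | cons s l ih =>
    obtain ⟨w, hxw, hwy⟩ := hl
    exact ⟨w, hxw, ih hwy⟩

theorem Chain.reverse {l : List E.EssentialAut} {x y : S} (hl : Chain l x y) :
    Chain (l.map inv).reverse y x := by
  induction l generalizing x with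
  | nil => exact Eq.symm hl
  | cons s l ih =>
    obtain ⟨w, hxw, hwy⟩ := hl
    rw [List.map_cons, List.reverse_cons]
    exact (ih hwy).append ⟨x, hxw.inv, rfl⟩

end EssentialAut

variable (E) in
/-- A decomposition of `φ` as in Alperin's fusion theorem: subgroups `P = P_0, …, P_n = P'`, all
open, and automorphisms `φ_i` of essential subgroups with `φ_i(P_{i-1}) = P_i` and
`φ = φ_n ⋯ φ_1`. The composite is evaluated at `u` through the sequence `x_0 = u`,
`x_i = φ_i(x_{i-1})`. -/
structure AlperinDecomposition (φ : P ≃* P') where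
  length : ℕ
  subgroup : Fin (length + 1) → ClosedSubgroup S
  step : Fin length → E.EssentialAut
  subgroup_zero : subgroup 0 = P
  subgroup_last : subgroup (Fin.last length) = P'
  isOpen : ∀ i, IsOpen (subgroup i : Set S)
  mapsOnto : ∀ i : Fin length, (step i).MapsOnto (subgroup i.castSucc) (subgroup i.succ)
  exists_path : ∀ u : P, ∃ x : Fin (length + 1) → S, x 0 = u ∧ x (Fin.last length) = φ u ∧
    ∀ i : Fin length, (step i).Rel (x i.castSucc) (x i.succ)

namespace AlperinDecomposition

/-- The decomposition of length `0`. -/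
def nil (hP : IsOpen (P : Set S)) {φ : P ≃* P'} (hφ : ∀ u : P, (u : S) = φ u) :
    E.AlperinDecomposition φ where
  length := 0
  subgroup _ := P
  step := Fin.elim0
  subgroup_zero := rfl
  subgroup_last := by
    refine SetLike.ext' ?_
    rw [← Subtype.range_coe (s := (P : Set S)), ← Subtype.range_coe (s := (P' : Set S)),
      ← φ.surjective.range_comp]
    exact congrArg Set.range (funext hφ)
  isOpen _ := hP
  mapsOnto i := i.elim0
  exists_path u := ⟨fun _ => u, rfl, hφ u, fun i => i.elim0⟩

/-- Composition of a decomposition with an automorphism of an essential subgroup, applied first. -/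
def cons (hP : IsOpen (P : Set S)) (s : E.EssentialAut) {θ : P ≃* Q} (hθ : ∀ u : P, s.Rel u (θ u))
    {φ : Q ≃* P'} (d : E.AlperinDecomposition φ) : E.AlperinDecomposition (θ.trans φ) where
  length := d.length + 1
  subgroup := Fin.cons P d.subgroup
  step := Fin.cons s d.step
  subgroup_zero := rfl
  subgroup_last := by rw [← Fin.succ_last, Fin.cons_succ, d.subgroup_last]
  isOpen := Fin.cases hP d.isOpen
  mapsOnto := Fin.cases (by simpa [d.subgroup_zero] using EssentialAut.mapsOnto_of_rel hθ) fun i =>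
    d.mapsOnto i
  exists_path u := by
    obtain ⟨x, hx0, hxlast, hx⟩ := d.exists_path (θ u)
    refine ⟨Fin.cons (u : S) x, rfl, ?_, Fin.cases ?_ hx⟩
    · rw [← Fin.succ_last, Fin.cons_succ, hxlast, MulEquiv.trans_apply]
    · simpa [hx0] using hθ u

theorem nonempty_of_chain {l : List E.EssentialAut} (hP : IsOpen (P : Set S)) {φ : P ≃* P'}
    (hl : ∀ u : P, EssentialAut.Chain l u (φ u)) : Nonempty (E.AlperinDecomposition φ) := by
  induction l generalizing P with
  | nil => exact ⟨nil hP hl⟩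
  | cons s l ih =>
    obtain ⟨P₁, θ, hθ, hsθ⟩ : ∃ (P₁ : ClosedSubgroup S) (θ : P ≃* P₁), HomFamily.IsIso E.Hom θ ∧
        ∀ u : P, s.Rel u (θ u) := EssentialAut.exists_isIso_rel fun x hx => by
      obtain ⟨_, hxw, _⟩ := hl ⟨x, hx⟩
      exact hxw.1
    have hP₁ : IsOpen (P₁ : Set S) := ProFusionSystem.isOpen_of_mem (E.subset _ _ hθ.1) hP
    obtain ⟨d⟩ := ih hP₁ (φ := θ.symm.trans φ) fun v => by
      obtain ⟨w, huw, hw⟩ := hl (θ.symm v)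
      have hwv : w = v := by simpa using huw.unique (hsθ (θ.symm v))
      exact hwv ▸ hw
    have hφ : θ.trans (θ.symm.trans φ) = φ := MulEquiv.ext fun u => by simp
    exact ⟨hφ ▸ d.cons hP s hsθ⟩

end AlperinDecomposition

variable (E) in
/-- `φ` is a restriction of a composite of automorphisms in `E` of open, `E`-essential and fully
normalized subgroups. In contrast to `AlperinDecomposition`, no intermediate subgroups are recorded;
they can be recovered as the images of `P`. -/
def Decomposes (φ : P ≃* Q) : Prop :=
  ∃ l : List E.EssentialAut, ∀ u : P, EssentialAut.Chain l u (φ u)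

theorem Decomposes.trans {φ : P ≃* Q} {ψ : Q ≃* R} (hφ : E.Decomposes φ) (hψ : E.Decomposes ψ) :
    E.Decomposes (φ.trans ψ) := by
  obtain ⟨l, hl⟩ := hφ
  obtain ⟨m, hm⟩ := hψ
  exact ⟨l ++ m, fun u => (hl u).append (hm (φ u))⟩

theorem Decomposes.symm {φ : P ≃* Q} (hφ : E.Decomposes φ) : E.Decomposes φ.symm := by
  obtain ⟨l, hl⟩ := hφ
  exact ⟨(l.map EssentialAut.inv).reverse, fun u => by simpa using (hl (φ.symm u)).reverse⟩

theorem Decomposes.restrict {φ : P ≃* Q} {ψ : P' ≃* Q'} (hφ : E.Decomposes φ) (hle : P' ≤ P)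
    (h : ∀ u : P', (φ ⟨u, hle u.2⟩ : S) = ψ u) : E.Decomposes ψ := by
  obtain ⟨l, hl⟩ := hφ
  exact ⟨l, fun u => h u ▸ hl ⟨u, hle u.2⟩⟩

theorem decomposes_of_essential (hQo : IsOpen (Q : Set S)) (hess : E.Essential Q)
    (hQ : E.FullyNormalized Q) (γ : E.aut Q) : E.Decomposes γ.1 :=
  ⟨[⟨Q, γ, hQo, hess, hQ⟩], fun u => ⟨_, ⟨u.2, rfl⟩, rfl⟩⟩

variable (E Q) in
/-- The group of all decomposable automorphisms of `Q`. -/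
def decomposableAut : Subgroup (E.aut Q) where
  carrier := {γ | E.Decomposes γ.1}
  one_mem' := ⟨[], fun _ => rfl⟩
  mul_mem' hα hβ := hβ.trans hα
  inv_mem' hα := hα.symm

variable (E) in
/-- Every isomorphism of `E` between open subgroups of index less than `n` decomposes: the inductive
hypothesis in the proof of Alperin's fusion theorem. -/
def DecomposesBelow (n : ℕ) : Prop :=
  ∀ (P P' : ClosedSubgroup S) (θ : P ≃* P'), IsOpen (P : Set S) → P.toSubgroup.index < n →
    HomFamily.IsIso E.Hom θ → E.Decomposes θ

theorem mem_normMul {t : S} (ht : t ∈ T) (htQ : t ∈ Subgroup.normalizer (Q : Set S)) :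
    t ∈ normMul T Q :=
  (le_sup_left : _ ≤ (normMul T Q).toSubgroup) ⟨ht, htQ⟩

theorem le_normMul : Q ≤ normMul T Q :=
  (le_sup_right : Q.toSubgroup ≤ (normMul T Q).toSubgroup)

theorem le_extDomain {φ : R ≃* Q} (hφ : HomFamily.IsIso E.Hom φ) : R ≤ E.extDomain φ hφ := by
  refine fun x hx => ⟨le_normMul hx, φ ⟨x, hx⟩, le_normMul (φ ⟨x, hx⟩).2, fun u => ?_⟩
  have hconj : φ (⟨x, hx⟩ * u * ⟨x, hx⟩⁻¹) = φ ⟨x, hx⟩ * φ u * (φ ⟨x, hx⟩)⁻¹ := by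
    simp only [map_mul, map_inv]
  exact congrArg Subtype.val hconj

theorem mem_extDomain_of_conj {φ : R ≃* Q} (hφ : HomFamily.IsIso E.Hom φ) {t : S} (ht : t ∈ T)
    (htR : t ∈ Subgroup.normalizer (R : Set S)) {c : MulAut R}
    (hc : ∀ x : R, (c x : S) = t * x * t⁻¹) (hφc : MulAut.congr φ c ∈ conjAut T.toSubgroup Q) :
    t ∈ E.extDomain φ hφ := by
  obtain ⟨s, ⟨hs, hsQ⟩, hsc⟩ := hφc
  refine ⟨mem_normMul ht htR, s, mem_normMul hs hsQ, fun u => ?_⟩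
  have hcu : (⟨t * u * t⁻¹, normMul_conj_mem (mem_normMul ht htR) u.2⟩ : R) = c u :=
    Subtype.ext (hc u).symm
  simpa [hcu] using hsc (φ u)

theorem mem_extDomain_of_mem_centralizer {φ : R ≃* Q} (hφ : HomFamily.IsIso E.Hom φ) {t : S}
    (ht : t ∈ T) (htR : t ∈ Subgroup.centralizer (R : Set S)) : t ∈ E.extDomain φ hφ := by
  refine mem_extDomain_of_conj hφ ht (Subgroup.centralizer_le_normalizer _ htR) (c := 1)
    (fun x => ?_) ((map_one (MulAut.congr φ)).symm ▸ one_mem _)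
  rw [← Subgroup.mem_centralizer_iff.1 htR x x.2, mul_inv_cancel_right, MulAut.one_apply]

theorem decomposes_of_mem_extDomain (hR : IsOpen (R : Set S))
    (ih : E.DecomposesBelow R.toSubgroup.index) (hQ : E.Receptive Q) {φ : R ≃* Q}
    (hφ : HomFamily.IsIso E.Hom φ) {t : S} (ht : t ∈ E.extDomain φ hφ) (htR : t ∉ R) :
    E.Decomposes φ := by
  obtain ⟨ψ, hψ, hψφ⟩ := hQ R φ hφ
  obtain ⟨R', hR', θ, hθ, rfl⟩ := E.factor hψ
  have hlt : R.toSubgroup < (E.extDomain φ hφ).toSubgroup :=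
    SetLike.lt_iff_le_and_exists.2 ⟨le_extDomain hφ, t, ht, htR⟩
  have := R.toSubgroup.quotient_finite_of_isOpen hR
  have := R.toSubgroup.finiteIndex_of_finite_quotient
  exact (ih _ _ θ (Subgroup.isOpen_mono hlt.le hR) (Subgroup.index_strictAnti hlt) hθ).restrict
    hlt.le fun u => hψφ ⟨u, hlt.le u.2⟩ u.2

theorem exists_mem_centralizer_notMem (hQ : E.Receptive Q) (hcent : ¬ E.Centric Q) :
    ∃ t ∈ T, t ∈ Subgroup.centralizer (Q : Set S) ∧ t ∉ Q := by
  simp only [Centric, not_forall, SetLike.not_le_iff_exists] at hcent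
  obtain ⟨Q', ⟨θ, hθ⟩, t, ⟨htT, htc⟩, htZ⟩ := hcent
  have htQ' : t ∉ Q' := fun ht => htZ ⟨⟨t, ht⟩, Subgroup.mem_center_iff.2 fun g =>
    Subtype.ext (Subgroup.mem_centralizer_iff.1 htc g g.2), rfl⟩
  obtain ⟨ψ, hψ, hψθ⟩ := hQ Q' θ.symm (isIso_symm hθ)
  let τ : E.extDomain θ.symm (isIso_symm hθ) :=
    ⟨t, mem_extDomain_of_mem_centralizer (isIso_symm hθ) htT htc⟩
  have hlift : ∀ v ∈ Q, ∃ w : E.extDomain θ.symm (isIso_symm hθ), (w : S) ∈ Q' ∧ (ψ w : S) = v :=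
    fun v hv => ⟨⟨θ ⟨v, hv⟩, le_extDomain _ (θ ⟨v, hv⟩).2⟩, (θ ⟨v, hv⟩).2, by
      rw [hψθ _ (θ ⟨v, hv⟩).2]
      exact congrArg Subtype.val (θ.symm_apply_apply ⟨v, hv⟩)⟩
  refine ⟨ψ τ, apply_mem hψ htT, Subgroup.mem_centralizer_iff.2 fun v hv => ?_, fun hτ => ?_⟩
  · obtain ⟨w, hw, rfl⟩ := hlift v hv
    have hcomm : w * τ = τ * w := Subtype.ext (Subgroup.mem_centralizer_iff.1 htc w hw)
    simpa using congrArg (fun z => (ψ z : S)) hcomm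
  · obtain ⟨w, hw, hwτ⟩ := hlift _ hτ
    have hwt : w = τ := injective_of_mem hψ (Subtype.ext hwτ)
    exact htQ' (show (τ : S) ∈ Q' from hwt ▸ hw)

theorem decomposes_of_conj_mem_innerAut (hQo : IsOpen (Q : Set S))
    (ih : E.DecomposesBelow Q.toSubgroup.index) (hQ : E.Receptive Q) {x γ : E.aut Q}
    (hx : x ∈ E.innerAut T.toSubgroup Q) (hxQ : x ∉ E.innerAut (T.toSubgroup ⊓ Q.toSubgroup) Q)
    (hγ : γ * x * γ⁻¹ ∈ E.innerAut T.toSubgroup Q) : E.Decomposes γ.1 := by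
  obtain ⟨t, ⟨ht, htQ⟩, htx⟩ := hx
  exact decomposes_of_mem_extDomain hQo ih hQ γ.2 (mem_extDomain_of_conj γ.2 ht htQ htx hγ)
    fun h => hxQ ⟨t, ⟨⟨ht, h⟩, htQ⟩, htx⟩

theorem decomposes_aut [Fact p.Prime] (hQo : IsOpen (Q : Set S))
    (ih : E.DecomposesBelow Q.toSubgroup.index) (hQ : E.FullyNormalized Q) (γ : E.aut Q) :
    E.Decomposes γ.1 := by
  by_cases hess : E.Essential Q
  · exact decomposes_of_essential hQo hess hQ γ
  by_cases hcent : E.Centric Q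
  · have hconn : PosetConnected
        (SpPoset p (E.aut Q ⧸ E.innerAut (T.toSubgroup ⊓ Q.toSubgroup) Q)) :=
      by_contra fun h => hess (.inr ⟨hcent, h⟩)
    have htop : E.decomposableAut Q = ⊤ :=
      hQ.2.eq_top_of_posetConnected (innerAut_mono inf_le_left) hconn fun _ hx hxQ _ hγ =>
        decomposes_of_conj_mem_innerAut hQo ih hQ.1 hx hxQ hγ
    exact htop.ge (Subgroup.mem_top γ)
  · obtain ⟨t, ht, htc, htQ⟩ := exists_mem_centralizer_notMem hQ.1 hcent
    exact decomposes_of_mem_extDomain hQo ih hQ.1 γ.2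
      (mem_extDomain_of_mem_centralizer γ.2 ht htc) htQ

omit [IsTopologicalGroup S] in
theorem eq_of_isIso_of_le {χ : R ≃* Q} (hχ : HomFamily.IsIso E.Hom χ) (hTR : T ≤ R) : Q = R := by
  have hQR : Q ≤ R := fun y hy => by
    have h : (χ.symm ⟨y, hy⟩ : S) * y⁻¹ ∈ R := hTR (apply_mul_inv_mem hχ.2 ⟨y, hy⟩)
    simpa using mul_mem (inv_mem h) (χ.symm ⟨y, hy⟩).2
  refine le_antisymm hQR fun x hx => ?_
  obtain ⟨z, hz⟩ := ProFusionSystem.surjective_of_mem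
    (E.subset _ _ (E.comp_mem (E.inclHom_mem hQR) hχ.1)) ⟨x, hx⟩
  have hzx : (χ z : S) = x := congrArg Subtype.val hz
  exact hzx ▸ (χ z).2

theorem exists_le_extDomain_trans [Fact p.Prime] (hQ : IsSylowProP p (E.innerAut T.toSubgroup Q))
    {χ : R ≃* Q} (hχ : HomFamily.IsIso E.Hom χ) :
    ∃ g : E.aut Q, T.toSubgroup ⊓ Subgroup.normalizer (R : Set S) ≤
      (E.extDomain (χ.trans g.1) (isIso_trans hχ g.2)).toSubgroup := by
  obtain ⟨g, hg⟩ := hQ.exists_conj_mem (Y := (E.innerAut T.toSubgroup R).map (autCongr hχ)) <| by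
    rintro _ ⟨α, hα, rfl⟩
    exact (isProPElement_of_mem_innerAut hα).map (continuous_autCongr hχ)
  refine ⟨g⁻¹, fun t ht => ?_⟩
  let c : MulAut R := R.toSubgroup.normalizerMonoidHom ⟨t, ht.2⟩
  have hc : c ∈ conjAut T.toSubgroup R := ⟨t, ht, fun _ => rfl⟩
  exact mem_extDomain_of_conj _ ht.1 ht.2 (c := c) (fun _ => rfl)
    (hg _ ⟨⟨c, E.conjAut_le_aut R hc⟩, hc, rfl⟩)

theorem decomposes_of_fullyNormalized [Fact p.Prime] (hRo : IsOpen (R : Set S))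
    (ih : E.DecomposesBelow R.toSubgroup.index) (hQ : E.FullyNormalized Q) {χ : R ≃* Q}
    (hχ : HomFamily.IsIso E.Hom χ) : E.Decomposes χ := by
  have hQo : IsOpen (Q : Set S) := ProFusionSystem.isOpen_of_mem (E.subset _ _ hχ.1) hRo
  have hindex : Q.toSubgroup.index = R.toSubgroup.index :=
    ProFusionSystem.index_eq_of_surjective (E.subset _ _ hχ.1) χ.surjective hRo
  have haut := decomposes_aut hQo (hindex ▸ ih) hQ
  by_cases hTR : T ≤ R
  · obtain rfl := eq_of_isIso_of_le hχ hTR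
    exact haut ⟨χ, hχ⟩
  have := E.normal
  obtain ⟨n, hn⟩ := F.exists_lowerCentralSeries_le (P := R.toSubgroup) hRo
  obtain ⟨t, ht, htn, htR⟩ := exists_mem_normalizer_notMem hn hTR
  obtain ⟨g, hg⟩ := exists_le_extDomain_trans hQ.2 hχ
  have hχg : E.Decomposes (χ.trans g.1) :=
    decomposes_of_mem_extDomain hRo ih hQ.1 (isIso_trans hχ g.2) (hg ⟨ht, htn⟩) htR
  exact (hχg.trans (haut g).symm).restrict le_rfl fun u => by simp

theorem decomposes_of_saturated [Fact p.Prime] (hE : E.Saturated) (hP : IsOpen (P : Set S))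
    {φ : P ≃* P'} (hφ : HomFamily.IsIso E.Hom φ) : E.Decomposes φ := by
  induction hn : P.toSubgroup.index using Nat.strong_induction_on generalizing P P' with
  | h n ih =>
    have hP' : IsOpen (P' : Set S) := ProFusionSystem.isOpen_of_mem (E.subset _ _ hφ.1) hP
    have hindex : P'.toSubgroup.index = P.toSubgroup.index :=
      ProFusionSystem.index_eq_of_surjective (E.subset _ _ hφ.1) φ.surjective hP
    have ih' : E.DecomposesBelow n := fun _ _ _ hR hlt hθ => ih _ hlt hR hθ rfl
    obtain ⟨Q, ⟨χ, hχ⟩, hQ⟩ := hE P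
    have hχ_dec := decomposes_of_fullyNormalized hP (hn ▸ ih') hQ hχ
    have hχ_dec' := decomposes_of_fullyNormalized hP' (hindex ▸ hn ▸ ih') hQ
      (isIso_trans (isIso_symm hφ) hχ)
    exact (hχ_dec.trans hχ_dec'.symm).restrict le_rfl fun u => by simp

end Decomposes

end TSubsystem

theorem mainTheorem1_general {p : ℕ} [Fact p.Prime] {S : Type u} [Group S] [TopologicalSpace S]
    [IsTopologicalGroup S] [CompactSpace S] [T2Space S]
    (F : ProFusionSystem.{u, v, w} p S) (T : ClosedSubgroup S)
    (E : TSubsystem F T) (hE : E.Saturated)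
    (P P' : ClosedSubgroup S) (hP : IsOpen (P : Set S))
    (φ : P ≃* P') (hφ : HomFamily.IsIso E.Hom φ) :
    ∃ (n : ℕ) (R : Fin (n + 1) → ClosedSubgroup S) (Q : Fin n → ClosedSubgroup S)
      (ψ : ∀ i : Fin n, E.aut (Q i)),
      R 0 = P ∧ R (Fin.last n) = P' ∧
      (∀ i, IsOpen (R i : Set S)) ∧ (∀ i, IsOpen (Q i : Set S)) ∧
      (∀ i, E.Essential (Q i) ∧ E.FullyNormalized (Q i)) ∧
      (∀ i : Fin n, R i.castSucc ≤ Q i ∧ R i.succ ≤ Q i ∧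
        ∀ y : S, y ∈ R i.succ ↔ ∃ x : Q i, (x : S) ∈ R i.castSucc ∧ ((ψ i).1 x : S) = y) ∧
      ∀ u : P, ∃ x : Fin (n + 1) → S, x 0 = u ∧ x (Fin.last n) = φ u ∧
        ∀ i : Fin n, ∃ hx : x i.castSucc ∈ Q i, x i.succ = (ψ i).1 ⟨x i.castSucc, hx⟩ := by
  obtain ⟨l, hl⟩ := TSubsystem.decomposes_of_saturated hE hP hφ
  obtain ⟨d⟩ := TSubsystem.AlperinDecomposition.nonempty_of_chain hP hl
  exact ⟨d.length, d.subgroup, fun i => (d.step i).domain, fun i => (d.step i).aut,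
    d.subgroup_zero, d.subgroup_last, d.isOpen, fun i => (d.step i).isOpen,
    fun i => ⟨(d.step i).essential, (d.step i).fullyNormalized⟩, d.mapsOnto, d.exists_path⟩

/-- The composite `φ_n ⋯ φ_1` is evaluated at `u ∈ P` through the sequence
`x_0 = u`, `x_i = φ_i(x_{i-1})`, in which `x_{i-1} ∈ P_{i-1} ≤ Q_i`. -/
theorem mainTheorem1 {p : ℕ} [Fact p.Prime] {S : Type u} [Group S] [TopologicalSpace S]
    [IsTopologicalGroup S] [CompactSpace S] [T2Space S]
    (F : ProFusionSystem.{u, v, w} p S) (T : ClosedSubgroup S) (hT : F.StronglyClosed T)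
    (E : TSubsystem F T) (hE : E.Saturated)
    (P P' : ClosedSubgroup S) (hP : IsOpen (P : Set S)) (hP' : IsOpen (P' : Set S))
    (φ : P ≃* P') (hφ : HomFamily.IsIso E.Hom φ) :
    ∃ (n : ℕ) (R : Fin (n + 1) → ClosedSubgroup S) (Q : Fin n → ClosedSubgroup S)
      (ψ : ∀ i : Fin n, E.aut (Q i)),
      R 0 = P ∧ R (Fin.last n) = P' ∧
      (∀ i, IsOpen (R i : Set S)) ∧ (∀ i, IsOpen (Q i : Set S)) ∧
      (∀ i, E.Essential (Q i) ∧ E.FullyNormalized (Q i)) ∧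
      (∀ i : Fin n, R i.castSucc ≤ Q i ∧ R i.succ ≤ Q i ∧
        ∀ y : S, y ∈ R i.succ ↔ ∃ x : Q i, (x : S) ∈ R i.castSucc ∧ ((ψ i).1 x : S) = y) ∧
      ∀ u : P, ∃ x : Fin (n + 1) → S, x 0 = u ∧ x (Fin.last n) = φ u ∧
        ∀ i : Fin n, ∃ hx : x i.castSucc ∈ Q i, x i.succ = (ψ i).1 ⟨x i.castSucc, hx⟩ :=
  mainTheorem1_general F T E hE P P' hP φ hφ
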